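/- Let $d\ge 1$ and $k\ge 0$ be integers, let $\Omega\subset\mathbb R^d$ be compact, and let $|\cdot|_*$ be a norm on $\mathbb R^d$. Put $m_\Omega=\sup_{\omega\in\Omega}|\omega|_2$ and let $b>0$ be the smallest constant with $|x|_2\le b|x|_*$ for all $x\in\mathbb R^d$. With $\hat f(\omega)=\int_{\mathbb R^d} f(x)e^{-i\omega\cdot x}\,dx$, let $$\mathrm B(\Omega)=\{f\in L^2(\mathbb R^d):\operatorname{supp}\hat f\subseteq\Omega\},\qquad \Phi_\Omega(x)=(2\pi)^{-d}\int_\Omega e^{i\omega\cdot x}\,d\omega .$$ Let $\{x_n\}_{n\in I}\subset\mathbb R^d$ be a countable family of sampling points with Voronoi cells, weights and density $$V_n=\{x:|x-x_n|_*\le|x-x_m|_*\ \forall m\ne n\},\qquad \mu_{n,\alpha}=\frac1{\alpha!}\int_{V_n}(x-x_n)^{2\alpha}\,dx,\qquad \delta=\sup_{x\in\mathbb R^d}\inf_{n\in I}|x-x_n|_* ,$$ and assume that the cells form a partition of $\mathbb R^d$ up to null sets, i.e. almost every $x\in\mathbb R^d$ belongs to exactly one $V_n$. For $z>0$ define $$R_k(z)=e^z-\sum_{r=0}^k\frac{z^r}{r!},\quad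 \sigma_d^*(z)=\frac{z+\sqrt{z(d+z)}}{d},\quad h_k(z)=e^zR_k(z),\quad g_{k,d}(z)=(1+2\sigma_d^*(z))^{d/2}e^{z/\sigma_d^*(z)}R_k(z),$$ with $h_k(0)=g_{k,d}(0)=0$ (the limits as $z\to0^+$), and let $H_k$, $G_{k,d}$ be the inverse functions of $h_k$, $g_{k,d}$ on $(0,\infty)$. Suppose that $$\delta<\frac{C(k,d)}{m_\Omega b},\qquad C(k,d)=\max\{H_k(1),G_{k,d}(1)\}$$ (if $m_\Omega=0$ this means $\delta<\infty$; $m_\Omega=0$ if $\Omega=\emptyset$). Then every $f\in\mathrm B(\Omega)$ has a smooth representative, again denoted $f$, and there are constants $A,B>0$ with $$A\ge e^{-d}\bigl(1-\min\{h_k(m_\Omega b\delta),g_{k,d}(m_\Omega b\delta)\}\bigr)^2,\qquad B\le\exp\bigl(2m_\Omega b\delta+(m_\Omega b\delta)^2\bigr),$$ such that $$A\|f\|^2\le\sum_{n\in I}\sum_{|\alpha|_1\le k}\mu_{n,\alpha}|D^\alpha f(x_n)|^2\le B\|f\|^2\qquad\text{for all } f\in\mathrm B(\Omega),$$ and the family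 $\{\sqrt{\mu_{n,\alpha}}\,D^\alpha\Phi_\Omega(\cdot-x_n):n\in I,\ |\alpha|_1\le k\}$ lies in $\mathrm B(\Omega)$ and is a frame for $\mathrm B(\Omega)$ with frame bounds $A$ and $B$. Moreover, for any constants $A,B>0$, the displayed two-sided inequality holds for all $f\in\mathrm B(\Omega)$ if and only if this family lies in $\mathrm B(\Omega)$ and is a frame for $\mathrm B(\Omega)$ with bounds $A$ and $B$. -/

import Mathlib

open MeasureTheory Set
open scoped ENNReal FourierTransform ContDiff

namespace DerivativeSampling

noncomputable section

/-! ### The functions `R_k`, `σ*_d`, `h_k`, `g_{k,d}` and the constant `C(k,d)` -/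

/-- The exponential remainder `R_k(z) = exp z - ∑_{r ≤ k} z^r / r!`. -/
def expRemainder (k : ℕ) (z : ℝ) : ℝ :=
  Real.exp z - ∑ r ∈ Finset.range (k + 1), z ^ r / (r.factorial : ℝ)

/-- `σ*_d(z) = (z + √(z (d + z))) / d`. -/
def sigmaStar (d : ℕ) (z : ℝ) : ℝ :=
  (z + Real.sqrt (z * (d + z))) / d

/-- `h_k(z) = exp z * R_k(z)`. -/
def hFun (k : ℕ) (z : ℝ) : ℝ :=
  Real.exp z * expRemainder k z

/-- `g_{k,d}(z) = (1 + 2 σ*_d(z))^{d/2} exp(z / σ*_d(z)) R_k(z)`. -/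
def gFun (k d : ℕ) (z : ℝ) : ℝ :=
  (1 + 2 * sigmaStar d z) ^ ((d : ℝ) / 2) * Real.exp (z / sigmaStar d z) * expRemainder k z

/-- The inverse function `H_k` of `h_k` on `(0, ∞)`. -/
def hInv (k : ℕ) (w : ℝ) : ℝ :=
  Function.invFunOn (hFun k) (Ioi 0) w

/-- The inverse function `G_{k,d}` of `g_{k,d}` on `(0, ∞)`. -/
def gInv (k d : ℕ) (w : ℝ) : ℝ :=
  Function.invFunOn (gFun k d) (Ioi 0) w

/-- `C(k,d) = max {H_k(1), G_{k,d}(1)}`. -/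
def densityConst (k d : ℕ) : ℝ :=
  max (hInv k 1) (gInv k d 1)

/-! ### Multi-indices and partial derivatives -/

/-- The partial derivative of `f` in the `j`-th coordinate. -/
def partialDeriv {d : ℕ} (j : Fin d) (f : EuclideanSpace ℝ (Fin d) → ℂ) :
    EuclideanSpace ℝ (Fin d) → ℂ :=
  fun x => lineDeriv ℝ f x (EuclideanSpace.single j 1)

/-- `D^α f = ∂₁^{α₁} (∂₂^{α₂} (⋯ (∂_d^{α_d} f)))`. -/
def multiDeriv {d : ℕ} (α : Fin d → ℕ) (f : EuclideanSpace ℝ (Fin d) → ℂ) :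
    EuclideanSpace ℝ (Fin d) → ℂ :=
  (List.finRange d).foldr (fun j g => (partialDeriv j)^[α j] g) f

/-- The finite set of multi-indices `α` with `|α|₁ ≤ k`. -/
def multiIndices (d k : ℕ) : Finset (Fin d → ℕ) :=
  (Fintype.piFinset fun _ : Fin d => Finset.range (k + 1)).filter fun α => ∑ j, α j ≤ k

theorem mem_multiIndices {d k : ℕ} {α : Fin d → ℕ} :
    α ∈ multiIndices d k ↔ ∑ j, α j ≤ k := by
  simp only [multiIndices, Finset.mem_filter, Fintype.mem_piFinset, Finset.mem_range,
    and_iff_right_iff_imp]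
  intro h j
  exact Nat.lt_succ_of_le ((Finset.single_le_sum (fun i _ => Nat.zero_le (α i))
    (Finset.mem_univ j)).trans h)

/-! ### Norms and the frequency domain -/

/-- The optimal constant `b > 0` with `|x|₂ ≤ b |x|_*` for all `x`. -/
def normConst {d : ℕ} (N : Seminorm ℝ (EuclideanSpace ℝ (Fin d))) : ℝ :=
  sInf {b : ℝ | 0 < b ∧ ∀ x, ‖x‖ ≤ b * N x}

/-- `m_Ω = sup_{ξ ∈ Ω} |ξ|₂`. -/
def domainRadius {d : ℕ} (Ω : Set (EuclideanSpace ℝ (Fin d))) : ℝ :=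
  sSup ((fun ξ => ‖ξ‖) '' Ω)

/-! ### Sampling points: Voronoi cells, weights, density -/

/-- The Voronoi cell `V_n` of the point `x_n` with respect to the norm `N`. -/
def voronoiCell {d : ℕ} {ι : Type*} (N : Seminorm ℝ (EuclideanSpace ℝ (Fin d)))
    (x : ι → EuclideanSpace ℝ (Fin d)) (n : ι) : Set (EuclideanSpace ℝ (Fin d)) :=
  {y | ∀ m, m ≠ n → N (y - x n) ≤ N (y - x m)}

/-- The weight `μ_{n,α} = (1/α!) ∫_{V_n} (y - x_n)^{2α} dy`. -/
def weight {d : ℕ} {ι : Type*} (N : Seminorm ℝ (EuclideanSpace ℝ (Fin d)))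
    (x : ι → EuclideanSpace ℝ (Fin d)) (n : ι) (α : Fin d → ℕ) : ℝ :=
  (1 / ∏ j, ((α j).factorial : ℝ)) *
    ∫ y in voronoiCell N x n, ∏ j, (y j - x n j) ^ (2 * α j)

/-- The density `δ = sup_y inf_n |y - x_n|_*`, as an extended number. -/
def density {d : ℕ} {ι : Type*} (N : Seminorm ℝ (EuclideanSpace ℝ (Fin d)))
    (x : ι → EuclideanSpace ℝ (Fin d)) : ℝ≥0∞ :=
  ⨆ y, ⨅ n, ENNReal.ofReal (N (y - x n))

/-! ### Bandlimited functions -/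

/-- The Fourier transform `f̂(ξ) = ∫ f(x) exp(-i ξ·x) dx` on `L²(ℝ^d)`. Mathlib's unitary transform
`𝓕` on `L²` uses the kernel `exp(-2π i ξ·x)`, so that `f̂(ξ) = (𝓕 f)(ξ / 2π)`. -/
def angularFourier {d : ℕ} (f : Lp ℂ 2 (volume : Measure (EuclideanSpace ℝ (Fin d)))) :
    EuclideanSpace ℝ (Fin d) → ℂ :=
  fun ξ => (𝓕 f : Lp ℂ 2 (volume : Measure (EuclideanSpace ℝ (Fin d)))) ((2 * Real.pi)⁻¹ • ξ)

theorem quasiMeasurePreserving_scale (d : ℕ) :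
    Measure.QuasiMeasurePreserving
      (fun ξ : EuclideanSpace ℝ (Fin d) => (2 * Real.pi)⁻¹ • ξ) volume volume := by
  have h : (2 * Real.pi)⁻¹ ≠ 0 := by positivity
  refine ⟨measurable_const_smul _, ?_⟩
  rw [Measure.map_addHaar_smul _ h]
  exact Measure.smul_absolutelyContinuous

/-- `B(Ω) = {f ∈ L²(ℝ^d) : supp f̂ ⊆ Ω}`. The support of the class `f̂` is the essential one: for
closed `Ω` it lies in `Ω` exactly if `f̂ = 0` almost everywhere outside `Ω`. -/
def bandlimited {d : ℕ} (Ω : Set (EuclideanSpace ℝ (Fin d))) :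
    Submodule ℂ (Lp ℂ 2 (volume : Measure (EuclideanSpace ℝ (Fin d)))) where
  carrier := {f | ∀ᵐ ξ, ξ ∉ Ω → angularFourier f ξ = 0}
  zero_mem' := by
    rw [Set.mem_ofPred_eq]
    have h0 : (𝓕 (0 : Lp ℂ 2 (volume : Measure (EuclideanSpace ℝ (Fin d)))) :
        Lp ℂ 2 (volume : Measure (EuclideanSpace ℝ (Fin d)))) = 0 :=
      (Lp.fourierTransformₗᵢ (EuclideanSpace ℝ (Fin d)) ℂ).map_zero
    filter_upwards with ξ _
    simp [angularFourier, h0]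
  add_mem' := by
    intro f g hf hg
    rw [Set.mem_ofPred_eq] at hf hg ⊢
    have h0 : (𝓕 (f + g) : Lp ℂ 2 (volume : Measure (EuclideanSpace ℝ (Fin d)))) = 𝓕 f + 𝓕 g :=
      (Lp.fourierTransformₗᵢ (EuclideanSpace ℝ (Fin d)) ℂ).map_add f g
    have h1 := (quasiMeasurePreserving_scale d).ae (Lp.coeFn_add
      (𝓕 f : Lp ℂ 2 (volume : Measure (EuclideanSpace ℝ (Fin d)))) (𝓕 g))
    filter_upwards [h1, hf, hg] with ξ hξ hfξ hgξ hΩ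
    have a := hfξ hΩ
    have b := hgξ hΩ
    simp only [angularFourier] at a b ⊢
    rw [h0, hξ, Pi.add_apply, a, b, add_zero]
  smul_mem' := by
    intro c f hf
    rw [Set.mem_ofPred_eq] at hf ⊢
    have h0 : (𝓕 (c • f) : Lp ℂ 2 (volume : Measure (EuclideanSpace ℝ (Fin d)))) = c • 𝓕 f :=
      (Lp.fourierTransformₗᵢ (EuclideanSpace ℝ (Fin d)) ℂ).map_smul c f
    have h1 := (quasiMeasurePreserving_scale d).ae (Lp.coeFn_smul c
      (𝓕 f : Lp ℂ 2 (volume : Measure (EuclideanSpace ℝ (Fin d)))))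
    filter_upwards [h1, hf] with ξ hξ hfξ hΩ
    have a := hfξ hΩ
    simp only [angularFourier] at a ⊢
    rw [h0, hξ, Pi.smul_apply, a, smul_zero]

/-- `Φ_Ω(x) = (2π)^{-d} ∫_Ω exp(i ξ·x) dξ`. -/
def kernelPhi {d : ℕ} (Ω : Set (EuclideanSpace ℝ (Fin d))) (x : EuclideanSpace ℝ (Fin d)) : ℂ :=
  (1 / (2 * (Real.pi : ℂ)) ^ d) *
    ∫ ξ in Ω, Complex.exp (Complex.I * ((∑ j, ξ j * x j : ℝ) : ℂ))

/-! ### Frames and the two formulations of stable sampling -/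

/-- The family `φ` is a frame for `H` with frame bounds `A, B > 0`. -/
def IsFrameWithBounds {ι H : Type*} [NormedAddCommGroup H] [InnerProductSpace ℂ H]
    (φ : ι → H) (A B : ℝ) : Prop :=
  0 < A ∧ 0 < B ∧ ∀ f : H,
    Summable (fun i => ‖inner ℂ (φ i) f‖ ^ 2) ∧
    A * ‖f‖ ^ 2 ≤ ∑' i, ‖inner ℂ (φ i) f‖ ^ 2 ∧
    ∑' i, ‖inner ℂ (φ i) f‖ ^ 2 ≤ B * ‖f‖ ^ 2

/-- Stable sampling with derivatives:
`A ‖f‖² ≤ ∑_n ∑_{|α|₁ ≤ k} μ_{n,α} |D^α f(x_n)|² ≤ B ‖f‖²` for all `f ∈ B(Ω)`.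
The point values are those of the (unique) smooth representative `F` of the class `f`, whose
existence is part of the assertion. -/
def StableSampling {d : ℕ} {ι : Type*} (Ω : Set (EuclideanSpace ℝ (Fin d)))
    (x : ι → EuclideanSpace ℝ (Fin d)) (μ : ι → (Fin d → ℕ) → ℝ) (k : ℕ) (A B : ℝ) : Prop :=
  ∀ f ∈ bandlimited Ω, ∃ F : EuclideanSpace ℝ (Fin d) → ℂ,
    ContDiff ℝ ∞ F ∧ f =ᵐ[volume] F ∧
    Summable (fun n => ∑ α ∈ multiIndices d k, μ n α * ‖multiDeriv α F (x n)‖ ^ 2) ∧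
    A * ‖f‖ ^ 2 ≤ ∑' n, ∑ α ∈ multiIndices d k, μ n α * ‖multiDeriv α F (x n)‖ ^ 2 ∧
    ∑' n, ∑ α ∈ multiIndices d k, μ n α * ‖multiDeriv α F (x n)‖ ^ 2 ≤ B * ‖f‖ ^ 2

/-- The functions `√μ_{n,α} D^α Φ_Ω(· - x_n)`, `n ∈ I`, `|α|₁ ≤ k`, belong to `B(Ω)` and form a
frame for `B(Ω)` with frame bounds `A` and `B`. -/
def KernelFrame {d : ℕ} {ι : Type*} (Ω : Set (EuclideanSpace ℝ (Fin d)))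
    (x : ι → EuclideanSpace ℝ (Fin d)) (μ : ι → (Fin d → ℕ) → ℝ) (k : ℕ) (A B : ℝ) : Prop :=
  ∃ φ : ι × {α // α ∈ multiIndices d k} → bandlimited Ω,
    (∀ p, (φ p : Lp ℂ 2 (volume : Measure (EuclideanSpace ℝ (Fin d)))) =ᵐ[volume]
      fun y => (Real.sqrt (μ p.1 p.2) : ℂ) *
        multiDeriv (p.2 : Fin d → ℕ) (fun z => kernelPhi Ω (z - x p.1)) y) ∧
    IsFrameWithBounds φ A B

end

end DerivativeSampling

namespace DerivativeSampling

/-! ### The inverse Fourier transform of integrable `L²` functions -/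

/-! The argument approximates `f` on each Voronoi cell by its Taylor polynomial of degree `k` at the
node. Write `f = 𝓕⁻ u`, where `u` is square integrable and vanishes for `2π|ξ| > m = m_Ω`, and put
`ρ = bδ`, `z = mρ`. Every cell `V_n` lies within Euclidean distance `ρ` of `x_n`. Let `E_s =
∑_{|α|=s} |D^α f|²/α!`. The multinomial theorem and Plancherel give the Bernstein bound `∫ E_s ≤
m^{2s}/s! ‖f‖²` (`BandSpectrum.lintegral_derivEnergy_le`), and Cauchy–Schwarz bounds the degree `s`
Taylor term by `|e|^{2s}/s! · E_s`.

Sampling enters through a constant `κ` with `∑ |V_n||w(x_n)|² ≤ κ‖w‖²` for all `w` in the band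
(`SampleBound`). Comparing `w(x_n)` with a majorant averaged over `V_n` gives `κ = e^{2z}`;
averaging over a ball of radius `r` about `x_n` gives `κ = (1 + ρ/r)^d e^{2mr}`. Applied to all
derivatives, this yields `∑ |V_n| E_s(x_n) ≤ κ m^{2s}/s! ‖f‖²`. Summing over `s ≤ k` with the
factors `ρ^{2s}` and `κ = e^{2z}` gives the upper bound `e^{2z+z²}`. Summing over `s > k` gives a
squared Taylor error of at most `κ R_k(z)² ‖f‖²`, which is at most `h_k(z)²‖f‖²` for the first `κ`
and at most `g_{k,d}(z)²‖f‖²` for the second with `r = ρ/(2σ*)`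
(`CellPartition.exists_sampleBound`).

The integral over the cells of the squared Taylor polynomials is at most `e^d` times the sampled
energy, since `∑ 1/α! ≤ e^d`. So with `p = min(h_k, g_{k,d})` the triangle inequality in `L²`
amounts to `(1-p)‖f‖ ≤ e^{d/2} S^{1/2}`, where `S` is the sampled energy; the density hypothesis
ensures `p < 1`. All estimates run in `ℝ≥0∞`, so finiteness matters only at the end.

The frame statement is the same inequality: by Plancherel `⟨D^α Φ_Ω(· - x_n), f⟩ = ± D^α f(x_n)`
(`exists_kernelAtom`), so the frame sum and the sampled energy coincide. -/

theorem integral_smul_fourierInv_eq {V : Type*} [NormedAddCommGroup V] [InnerProductSpace ℝ V]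
    [FiniteDimensional ℝ V] [MeasurableSpace V] [BorelSpace V] (ψ : SchwartzMap V ℂ) {u : V → ℂ}
    (hu : Integrable u) : ∫ x, (𝓕⁻ ψ : SchwartzMap V ℂ) x • u x = ∫ x, ψ x • 𝓕⁻ u x := by
  have h := VectorFourier.integral_fourierIntegral_smul_eq_flip (L := innerₗ V) (μ := volume)
    (ν := volume) (f := ψ) (g := fun x => u (-x))
    Real.continuous_fourierChar continuous_inner ψ.integrable hu.comp_neg
  rw [flip_innerₗ] at h
  calc ∫ x, (𝓕⁻ ψ : SchwartzMap V ℂ) x • u x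
      = ∫ x, (𝓕⁻ ψ : SchwartzMap V ℂ) (-x) • u (-x) :=
        (integral_neg_eq_self (fun x => (𝓕⁻ ψ : SchwartzMap V ℂ) x • u x) volume).symm
    _ = ∫ x, 𝓕 (ψ : V → ℂ) x • u (-x) := by
        congr 1; ext x
        rw [SchwartzMap.fourierInv_coe, Real.fourierInv_eq_fourier_neg, neg_neg]
    _ = ∫ x, ψ x • 𝓕 (fun x => u (-x)) x := h
    _ = _ := by rw [Real.fourierInv_eq_fourier_comp_neg]

theorem continuous_fourierInv {V : Type*} [NormedAddCommGroup V] [InnerProductSpace ℝ V]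
    [FiniteDimensional ℝ V] [MeasurableSpace V] [BorelSpace V] {u : V → ℂ}
    (hu : Integrable u) : Continuous (𝓕⁻ u) := by
  rw [Real.fourierInv_eq_fourier_comp_neg]
  exact VectorFourier.fourierIntegral_continuous Real.continuous_fourierChar
    continuous_inner hu.comp_neg

/-- On `L¹ ∩ L²` the inverse Fourier transform on `L²` is given by the integral. -/
theorem Lp_fourierInv_ae_eq {V : Type*} [NormedAddCommGroup V] [InnerProductSpace ℝ V]
    [FiniteDimensional ℝ V] [MeasurableSpace V] [BorelSpace V] (u : Lp ℂ 2 (volume : Measure V))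
    (hu : Integrable u) : (𝓕⁻ u : Lp ℂ 2 (volume : Measure V)) =ᵐ[volume] 𝓕⁻ (u : V → ℂ) := by
  apply ae_eq_of_integral_contDiff_smul_eq
  · exact (Lp.memLp _).locallyIntegrable (by norm_num)
  · exact (continuous_fourierInv hu).locallyIntegrable
  · intro g g_smooth g_cpt
    have hg₁ : HasCompactSupport (Complex.ofRealCLM ∘ g) := g_cpt.comp_left rfl
    have hg₂ : ContDiff ℝ ∞ (Complex.ofRealCLM ∘ g) := by fun_prop
    set ψ := hg₁.toSchwartzMap hg₂ with hψ
    have hval : ∀ x, ψ x = (g x : ℂ) := fun x => rfl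
    have h1 : (Lp.toTemperedDistribution (𝓕⁻ u : Lp ℂ 2 (volume : Measure V))) ψ =
        (Lp.toTemperedDistribution u) (𝓕⁻ ψ) := by
      rw [← Lp.fourierInv_toTemperedDistribution_eq, TemperedDistribution.fourierInv_apply]
    rw [Lp.toTemperedDistribution_apply, Lp.toTemperedDistribution_apply,
      integral_smul_fourierInv_eq ψ hu] at h1
    simpa [hval] using h1

theorem Lp_enorm_sq_eq_lintegral {X : Type*} [MeasurableSpace X] {μ : Measure X} (f : Lp ℂ 2 μ) :
    ‖f‖ₑ ^ 2 = ∫⁻ x, ‖f x‖ₑ ^ 2 ∂μ := by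
  rw [Lp.enorm_def, eLpNorm_eq_lintegral_rpow_enorm_toReal (by norm_num) (by norm_num)]
  simp only [ENNReal.toReal_ofNat, ENNReal.rpow_ofNat, one_div]
  rw [← ENNReal.rpow_natCast, ← ENNReal.rpow_mul]
  norm_num

theorem lintegral_enorm_sq_fourierInv {V : Type*} [NormedAddCommGroup V] [InnerProductSpace ℝ V]
    [FiniteDimensional ℝ V] [MeasurableSpace V] [BorelSpace V] {u : V → ℂ}
    (hu : MemLp u 2) (hu1 : Integrable u) :
    ∫⁻ x, ‖𝓕⁻ u x‖ₑ ^ 2 = ∫⁻ x, ‖u x‖ₑ ^ 2 := by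
  have hc := hu.coeFn_toLp
  have hint : Integrable (hu.toLp u) := hu1.congr hc.symm
  have h1 := Lp_fourierInv_ae_eq (hu.toLp u) hint
  have h2 : 𝓕⁻ (hu.toLp u : V → ℂ) = 𝓕⁻ u := by
    ext x; exact Real.fourierInv_congr_ae hc x
  rw [h2] at h1
  have h3 : ‖(𝓕⁻ (hu.toLp u) : Lp ℂ 2 (volume : Measure V))‖ₑ = ‖hu.toLp u‖ₑ := by
    have : ‖(𝓕⁻ (hu.toLp u) : Lp ℂ 2 (volume : Measure V))‖ = ‖hu.toLp u‖ :=
      (Lp.fourierTransformₗᵢ V ℂ).symm.norm_map _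
    simp only [← ofReal_norm, this]
  calc ∫⁻ x, ‖𝓕⁻ u x‖ₑ ^ 2
      = ∫⁻ x, ‖(𝓕⁻ (hu.toLp u) : Lp ℂ 2 (volume : Measure V)) x‖ₑ ^ 2 :=
        lintegral_congr_ae (h1.mono fun x hx => by simp only [hx])
    _ = ∫⁻ x, ‖hu.toLp u x‖ₑ ^ 2 := by
        rw [← Lp_enorm_sq_eq_lintegral, ← Lp_enorm_sq_eq_lintegral, h3]
    _ = _ := lintegral_congr_ae (hc.mono fun x hx => by simp only [hx])

/-! ### Band-limited spectra -/

/-- `u` is square integrable and vanishes almost everywhere outside the ball `2π ‖ξ‖ ≤ R`. -/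
structure BandSpectrum {d : ℕ} (R : ℝ) (u : EuclideanSpace ℝ (Fin d) → ℂ) : Prop where
  memLp : MemLp u 2
  vanish : ∀ᵐ ξ, R < 2 * Real.pi * ‖ξ‖ → u ξ = 0

variable {d : ℕ}

theorem BandSpectrum.integrable {R : ℝ} {u : EuclideanSpace ℝ (Fin d) → ℂ}
    (hu : BandSpectrum R u) : Integrable u := by
  set B := Metric.closedBall (0 : EuclideanSpace ℝ (Fin d)) (R / (2 * Real.pi))
  have hB : IntegrableOn u B := by
    have : IsFiniteMeasure (volume.restrict B) :=
      ⟨by simpa using (isCompact_closedBall _ _).measure_lt_top⟩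
    exact (hu.memLp.restrict B).integrable (by norm_num)
  refine hB.integrable_of_ae_notMem_eq_zero ?_
  filter_upwards [hu.vanish] with ξ hξ hB
  apply hξ
  rw [mem_closedBall_zero_iff, not_le, div_lt_iff₀ (by positivity)] at hB
  linarith

theorem BandSpectrum.mul {R : ℝ} {u : EuclideanSpace ℝ (Fin d) → ℂ}
    (hu : BandSpectrum R u) {φ : EuclideanSpace ℝ (Fin d) → ℂ} (hφ : AEStronglyMeasurable φ) {C : ℝ}
    (hC : ∀ ξ, 2 * Real.pi * ‖ξ‖ ≤ R → ‖φ ξ‖ ≤ C) : BandSpectrum R (fun ξ => φ ξ * u ξ) := by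
  refine ⟨hu.memLp.of_le_mul (c := C) (hφ.mul hu.memLp.1) ?_, ?_⟩
  · filter_upwards [hu.vanish] with ξ hξ
    by_cases h : R < 2 * Real.pi * ‖ξ‖
    · simp [hξ h]
    · rw [norm_mul]
      exact mul_le_mul_of_nonneg_right (hC ξ (not_lt.1 h)) (norm_nonneg _)
  · filter_upwards [hu.vanish] with ξ hξ h
    rw [hξ h, mul_zero]

theorem BandSpectrum.mul_continuous {R : ℝ} {u : EuclideanSpace ℝ (Fin d) → ℂ}
    (hu : BandSpectrum R u) {φ : EuclideanSpace ℝ (Fin d) → ℂ} (hφ : Continuous φ) :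
    BandSpectrum R (fun ξ => φ ξ * u ξ) := by
  obtain ⟨C, hC⟩ := (isCompact_closedBall (0 : EuclideanSpace ℝ (Fin d))
    (R / (2 * Real.pi))).exists_bound_of_continuousOn hφ.continuousOn
  refine hu.mul hφ.aestronglyMeasurable (C := C) fun ξ hξ => hC ξ ?_
  rw [mem_closedBall_zero_iff, le_div_iff₀ (by positivity)]
  linarith

theorem BandSpectrum.comp_neg {R : ℝ} {u : EuclideanSpace ℝ (Fin d) → ℂ}
    (hu : BandSpectrum R u) : BandSpectrum R (fun ξ => u (-ξ)) := by
  have hn := Measure.measurePreserving_neg (volume : Measure (EuclideanSpace ℝ (Fin d)))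
  refine ⟨hu.memLp.comp_measurePreserving hn, ?_⟩
  filter_upwards [hn.quasiMeasurePreserving.ae hu.vanish] with ξ hξ h
  exact hξ (by rwa [norm_neg])

theorem BandSpectrum.integrable_pow_mul {R : ℝ} {u : EuclideanSpace ℝ (Fin d) → ℂ}
    (hu : BandSpectrum R u) (n : ℕ) : Integrable (fun ξ => ‖ξ‖ ^ n * ‖u ξ‖) := by
  have h := (hu.mul_continuous (φ := fun ξ => ((‖ξ‖ ^ n : ℝ) : ℂ)) (by fun_prop)).integrable.norm
  refine h.congr (Filter.Eventually.of_forall fun ξ => ?_)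
  simp only [norm_mul, Complex.norm_real, Real.norm_eq_abs, abs_pow, abs_norm]

/-- A spectrum of bounded support has finite moments of every order, so the Fourier integral may be
differentiated arbitrarily often. This supplies the smooth representative. -/
theorem BandSpectrum.contDiff {R : ℝ} {u : EuclideanSpace ℝ (Fin d) → ℂ}
    (hu : BandSpectrum R u) : ContDiff ℝ ∞ (𝓕⁻ u) := by
  rw [Real.fourierInv_eq_fourier_comp_neg]
  exact Real.contDiff_fourier (N := ⊤) fun n _ => hu.comp_neg.integrable_pow_mul n

theorem BandSpectrum.lineDeriv {R : ℝ} {u : EuclideanSpace ℝ (Fin d) → ℂ}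
    (hu : BandSpectrum R u) (x v : EuclideanSpace ℝ (Fin d)) :
    lineDeriv ℝ (𝓕⁻ u) x v =
      𝓕⁻ (fun ξ => (2 * Real.pi * Complex.I * (inner ℝ ξ v : ℝ)) * u ξ) x := by
  rw [Real.fourierInv_eq_fourier_comp_neg, Real.fourierInv_eq_fourier_comp_neg]
  have h1 := hu.comp_neg.integrable
  have h2 : Integrable (fun ξ => ‖ξ‖ * ‖u (-ξ)‖) := by simpa using hu.comp_neg.integrable_pow_mul 1
  rw [(Real.hasFDerivAt_fourier h1 h2 x).hasLineDerivAt v |>.lineDeriv,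
    Real.fourier_continuousLinearMap_apply]
  · refine congrArg (fun w : EuclideanSpace ℝ (Fin d) → ℂ => (𝓕 w : EuclideanSpace ℝ (Fin d) → ℂ) x)
      (funext fun ξ => ?_)
    have e : innerSL ℝ ξ v = inner ℝ ξ v := rfl
    simp only [VectorFourier.fourierSMulRight_apply, inner_neg_left]
    simp [e]
    ring
  · refine (h2.const_mul (2 * Real.pi)).mono' ?_ (Filter.Eventually.of_forall fun ξ => ?_)
    · exact h1.1.fourierSMulRight
    · refine (VectorFourier.norm_fourierSMulRight_le _ _ _).trans ?_
      have := norm_innerSL_le ℝ (E := EuclideanSpace ℝ (Fin d))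
      have h0 : 0 ≤ ‖ξ‖ * ‖u (-ξ)‖ := by positivity
      nlinarith [mul_le_mul_of_nonneg_right this h0, Real.pi_pos]

/-- The Fourier multiplier `(2πi ξ)^α` of `D^α`. -/
noncomputable def derivSymbol (α : Fin d → ℕ) (ξ : EuclideanSpace ℝ (Fin d)) : ℂ :=
  ∏ j, (2 * Real.pi * Complex.I * (ξ j : ℝ)) ^ α j

theorem continuous_derivSymbol (α : Fin d → ℕ) : Continuous (derivSymbol α) := by
  unfold derivSymbol; fun_prop

theorem BandSpectrum.multiDeriv {R : ℝ} {u : EuclideanSpace ℝ (Fin d) → ℂ}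
    (hu : BandSpectrum R u) (α : Fin d → ℕ) :
    multiDeriv α (𝓕⁻ u) = 𝓕⁻ (fun ξ => derivSymbol α ξ * u ξ) := by
  have hpart : ∀ (j : Fin d) (n : ℕ) {w : EuclideanSpace ℝ (Fin d) → ℂ}, BandSpectrum R w →
      (partialDeriv j)^[n] (𝓕⁻ w) =
        𝓕⁻ (fun ξ => (2 * Real.pi * Complex.I * (ξ j : ℝ)) ^ n * w ξ) := by
    intro j n w hw
    induction n with
    | zero => simp
    | succ n ih =>
      rw [Function.iterate_succ_apply', ih]
      have hw' := hw.mul_continuous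
        (φ := fun ξ => (2 * Real.pi * Complex.I * (ξ j : ℝ)) ^ n) (by fun_prop)
      ext x
      rw [partialDeriv, hw'.lineDeriv]
      refine congrArg (fun w : EuclideanSpace ℝ (Fin d) → ℂ =>
        (𝓕⁻ w : EuclideanSpace ℝ (Fin d) → ℂ) x) (funext fun ξ => ?_)
      simp only [EuclideanSpace.inner_single_right]
      simp
      ring
  have hlist : ∀ l : List (Fin d), l.foldr (fun j g => (partialDeriv j)^[α j] g) (𝓕⁻ u) =
      𝓕⁻ (fun ξ => (l.map fun j => (2 * Real.pi * Complex.I * (ξ j : ℝ)) ^ α j).prod * u ξ) := by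
    intro l
    induction l with
    | nil => simp
    | cons j l ih =>
      rw [List.foldr_cons, ih, hpart j (α j)]
      · congr 1; ext ξ; simp only [List.map_cons, List.prod_cons]; ring
      · refine hu.mul_continuous ?_
        refine continuous_list_prod _ fun i _ => by fun_prop
  rw [DerivativeSampling.multiDeriv, hlist]
  refine congrArg (fun w : EuclideanSpace ℝ (Fin d) → ℂ =>
    (𝓕⁻ w : EuclideanSpace ℝ (Fin d) → ℂ)) (funext fun ξ => ?_)
  rw [derivSymbol, ← List.prod_ofFn, List.ofFn_eq_map]

theorem fourierInv_add_eq (u : EuclideanSpace ℝ (Fin d) → ℂ) (y e : EuclideanSpace ℝ (Fin d)) :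
    𝓕⁻ u (y + e) =
      𝓕⁻ (fun ξ => Complex.exp (2 * Real.pi * Complex.I * (inner ℝ ξ e : ℝ)) * u ξ) y := by
  rw [Real.fourierInv_eq', Real.fourierInv_eq']
  congr 1
  ext ξ
  rw [smul_eq_mul, smul_eq_mul, ← mul_assoc, ← Complex.exp_add, inner_add_right]
  congr 2
  push_cast
  ring

end DerivativeSampling

namespace DerivativeSampling

/-! ### Auxiliary series and inequalities -/

/-- The multinomial theorem in the normalisation that produces all the constants: `|ξ|^{2s}/s!` in
the Bernstein bound, `|e|^{2s}/s!` in the Taylor bound, `d^s/s!` in `∑ 1/α!`, and the splitting of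
`⟨ξ,e⟩^s/s!` into monomials. -/
theorem sum_pow_div_factorial {K : Type*} [Field K] [CharZero K] {d : ℕ} (f : Fin d → K) (s : ℕ) :
    (∑ j, f j) ^ s / (s.factorial : K) =
      ∑ α ∈ Finset.piAntidiag Finset.univ s,
        (∏ j, f j ^ α j) / ∏ j, ((α j).factorial : K) := by
  rw [Finset.sum_pow_eq_sum_piAntidiag, Finset.sum_div]
  refine Finset.sum_congr rfl fun α hα => ?_
  have hs : ∑ j, α j = s := (Finset.mem_piAntidiag.1 hα).1
  have h := Nat.multinomial_spec Finset.univ α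
  rw [hs] at h
  have h' : (∏ j, ((α j).factorial : K)) * (Nat.multinomial Finset.univ α : K) =
      (s.factorial : K) := by exact_mod_cast h
  have h1 : (∏ j, ((α j).factorial : K)) ≠ 0 :=
    Finset.prod_ne_zero_iff.2 fun j _ => Nat.cast_ne_zero.2 (Nat.factorial_ne_zero _)
  have h2 : (s.factorial : K) ≠ 0 := Nat.cast_ne_zero.2 (Nat.factorial_ne_zero _)
  rw [div_eq_div_iff h2 h1, ← h']
  ring

theorem ennreal_sq_le_iff_le_rpow_half (a b : ℝ≥0∞) : a ^ 2 ≤ b ↔ a ≤ b ^ (1 / 2 : ℝ) := by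
  rw [one_div, ENNReal.le_rpow_inv_iff (by norm_num), ENNReal.rpow_ofNat]

/-- Cauchy–Schwarz for finite sums with weights. -/
theorem ennreal_sq_sum_le_mul_of_sq_le_mul {ι : Type*} (s : Finset ι) {t w v : ι → ℝ≥0∞}
    (h : ∀ i ∈ s, t i ^ 2 ≤ w i * v i) :
    (∑ i ∈ s, t i) ^ 2 ≤ (∑ i ∈ s, w i) * ∑ i ∈ s, v i := by
  rw [ennreal_sq_le_iff_le_rpow_half]
  have h1 := ENNReal.inner_le_Lp_mul_Lq s (fun i => w i ^ (1 / 2 : ℝ)) (fun i => v i ^ (1 / 2 : ℝ))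
    Real.HolderConjugate.two_two
  simp only [← ENNReal.rpow_mul] at h1
  norm_num at h1
  rw [← ENNReal.mul_rpow_of_nonneg _ _ (by norm_num)] at h1
  calc ∑ i ∈ s, t i ≤ ∑ i ∈ s, w i ^ (1 / 2 : ℝ) * v i ^ (1 / 2 : ℝ) := by
        refine Finset.sum_le_sum fun i hi => ?_
        rw [← ENNReal.mul_rpow_of_nonneg _ _ (by norm_num)]
        exact (ennreal_sq_le_iff_le_rpow_half _ _).1 (h i hi)
    _ ≤ ((∑ i ∈ s, w i) * ∑ i ∈ s, v i) ^ (1 / 2 : ℝ) := h1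

/-- Cauchy–Schwarz for series with weights. -/
theorem ennreal_sq_tsum_le_mul_of_sq_le_mul {ι : Type*} {t w v : ι → ℝ≥0∞}
    (h : ∀ i, t i ^ 2 ≤ w i * v i) : (∑' i, t i) ^ 2 ≤ (∑' i, w i) * ∑' i, v i := by
  rw [ennreal_sq_le_iff_le_rpow_half]
  refine ENNReal.summable.tsum_le_of_sum_le fun s => ?_
  rw [← ennreal_sq_le_iff_le_rpow_half]
  refine (ennreal_sq_sum_le_mul_of_sq_le_mul s fun i _ => h i).trans ?_
  gcongr <;> exact ENNReal.sum_le_tsum s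

/-- The tail `∑_{r ≥ K} z^r / r!` of the exponential series. -/
noncomputable def expTail (K : ℕ) (z : ℝ) : ℝ≥0∞ :=
  ∑' i : ℕ, ENNReal.ofReal (z ^ (i + K) / ((i + K).factorial : ℝ))

theorem expTail_eq (K : ℕ) {z : ℝ} (hz : 0 ≤ z) :
    expTail K z = ENNReal.ofReal
      (Real.exp z - ∑ r ∈ Finset.range K, z ^ r / (r.factorial : ℝ)) := by
  have h := (hasSum_nat_add_iff' K).2 (NormedSpace.expSeries_div_hasSum_exp z)
  rw [← Real.exp_eq_exp_ℝ] at h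
  rw [expTail, ← ENNReal.ofReal_tsum_of_nonneg (fun i => by positivity) h.summable, h.tsum_eq]

theorem expTail_zero {z : ℝ} (hz : 0 ≤ z) : expTail 0 z = ENNReal.ofReal (Real.exp z) := by
  rw [expTail_eq 0 hz]; simp

theorem expTail_succ (k : ℕ) {z : ℝ} (hz : 0 ≤ z) :
    expTail (k + 1) z = ENNReal.ofReal (expRemainder k z) := expTail_eq _ hz

/-- The weight `(ρ/m)^s` balances Cauchy–Schwarz: multiplied by the Bernstein factor `m^{2s}/s!` it
reproduces `(mρ)^s/s!`, so both Cauchy–Schwarz factors become the same exponential tail. -/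
theorem expTail_eq_weighted (K : ℕ) {m ρ : ℝ} (hm : 0 < m) (hρ : 0 ≤ ρ) :
    ∑' i : ℕ, ENNReal.ofReal ((ρ / m) ^ (i + K)) *
      ENNReal.ofReal (m ^ (2 * (i + K)) / ((i + K).factorial : ℝ)) = expTail K (m * ρ) := by
  refine tsum_congr fun i => ?_
  rw [← ENNReal.ofReal_mul (by positivity)]
  congr 1
  rw [div_pow, mul_pow, two_mul, pow_add _ (i + K)]
  field_simp

variable {d : ℕ}

/-! ### Taylor expansion of band-limited functions -/

/-- The energy `∑_{|α| = s} |D^α F(x)|² / α!` of the derivatives of order `s` of `F = 𝓕⁻ u`. -/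
noncomputable def derivEnergy (u : EuclideanSpace ℝ (Fin d) → ℂ) (s : ℕ)
    (x : EuclideanSpace ℝ (Fin d)) : ℝ≥0∞ :=
  ∑ α ∈ Finset.piAntidiag Finset.univ s,
    ENNReal.ofReal (1 / ∏ j, ((α j).factorial : ℝ)) * ‖𝓕⁻ (fun ξ => derivSymbol α ξ * u ξ) x‖ₑ ^ 2

/-- The homogeneous part of degree `s` of the Taylor expansion of `𝓕⁻ u` at `x`. -/
noncomputable def taylorTerm (u : EuclideanSpace ℝ (Fin d) → ℂ) (s : ℕ)
    (x e : EuclideanSpace ℝ (Fin d)) : ℂ :=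
  ∑ α ∈ Finset.piAntidiag Finset.univ s,
    (((∏ j, e j ^ α j) / ∏ j, ((α j).factorial : ℝ) : ℝ) : ℂ) *
      𝓕⁻ (fun ξ => derivSymbol α ξ * u ξ) x

theorem BandSpectrum.derivSymbol_mul {R : ℝ} {u : EuclideanSpace ℝ (Fin d) → ℂ}
    (hu : BandSpectrum R u) (α : Fin d → ℕ) : BandSpectrum R (fun ξ => derivSymbol α ξ * u ξ) :=
  hu.mul_continuous (continuous_derivSymbol α)

theorem BandSpectrum.measurable_derivEnergy {R : ℝ} {u : EuclideanSpace ℝ (Fin d) → ℂ}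
    (hu : BandSpectrum R u) (s : ℕ) : Measurable (derivEnergy u s) := by
  refine Finset.measurable_fun_sum _ fun α _ => ?_
  exact ((continuous_fourierInv (hu.derivSymbol_mul α).integrable).measurable.enorm.pow_const
    2).const_mul _

theorem sum_enorm_derivSymbol_sq (s : ℕ) (ξ : EuclideanSpace ℝ (Fin d)) :
    ∑ α ∈ Finset.piAntidiag Finset.univ s,
      ENNReal.ofReal (1 / ∏ j, ((α j).factorial : ℝ)) * ‖derivSymbol α ξ‖ₑ ^ 2 =
      ENNReal.ofReal ((2 * Real.pi * ‖ξ‖) ^ (2 * s) / (s.factorial : ℝ)) := by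
  have h := sum_pow_div_factorial (fun j => (2 * Real.pi * ξ j) ^ 2) s
  have h1 : ∑ j, (2 * Real.pi * ξ j) ^ 2 = (2 * Real.pi * ‖ξ‖) ^ 2 := by
    simp only [mul_pow, EuclideanSpace.norm_sq_eq, Finset.mul_sum, Real.norm_eq_abs, sq_abs]
  rw [h1, ← pow_mul] at h
  rw [h, ENNReal.ofReal_sum_of_nonneg]
  · refine Finset.sum_congr rfl fun α _ => ?_
    rw [← ofReal_norm, ← ENNReal.ofReal_pow (norm_nonneg _), ← ENNReal.ofReal_mul (by positivity)]
    congr 1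
    rw [derivSymbol, norm_prod, ← Finset.prod_pow, one_div, div_eq_mul_inv, mul_comm]
    congr 1
    refine Finset.prod_congr rfl fun j _ => ?_
    simp only [norm_pow, norm_mul, Complex.norm_real, Complex.norm_I, Complex.norm_ofNat,
      Real.norm_eq_abs, abs_of_pos Real.pi_pos, mul_one]
    rw [← pow_mul, mul_comm (α j) 2, pow_mul, mul_pow, sq_abs, ← mul_pow]
  · intro α _
    refine div_nonneg (Finset.prod_nonneg fun j _ => by positivity) (by positivity)

theorem BandSpectrum.lintegral_derivEnergy {R : ℝ} {u : EuclideanSpace ℝ (Fin d) → ℂ}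
    (hu : BandSpectrum R u) (s : ℕ) :
    ∫⁻ x, derivEnergy u s x = ∑ α ∈ Finset.piAntidiag Finset.univ s,
      ENNReal.ofReal (1 / ∏ j, ((α j).factorial : ℝ)) * ∫⁻ ξ, ‖derivSymbol α ξ * u ξ‖ₑ ^ 2 := by
  unfold derivEnergy
  rw [lintegral_finsetSum]
  · refine Finset.sum_congr rfl fun α _ => ?_
    rw [lintegral_const_mul' _ _ ENNReal.ofReal_ne_top, lintegral_enorm_sq_fourierInv
      (hu.derivSymbol_mul α).memLp (hu.derivSymbol_mul α).integrable]
  · intro α _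
    exact ((continuous_fourierInv
      (hu.derivSymbol_mul α).integrable).measurable.enorm.pow_const 2).const_mul _

/-- Bernstein's inequality for all derivatives of order `s` at once: Plancherel turns the energy
into the integral of `(2π|ξ|)^{2s}/s! · |u|²`, and `2π|ξ| ≤ m` where `u` does not vanish. -/
theorem BandSpectrum.lintegral_derivEnergy_le {m : ℝ} {u : EuclideanSpace ℝ (Fin d) → ℂ}
    (hu : BandSpectrum m u) (s : ℕ) :
    ∫⁻ x, derivEnergy u s x ≤
      ENNReal.ofReal (m ^ (2 * s) / (s.factorial : ℝ)) * ∫⁻ ξ, ‖u ξ‖ₑ ^ 2 := by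
  have hmeas : ∀ α, AEMeasurable (fun ξ => ‖derivSymbol α ξ * u ξ‖ₑ ^ 2) := fun α =>
    ((hu.derivSymbol_mul α).memLp.1.enorm.pow_const 2)
  calc ∫⁻ x, derivEnergy u s x
      = ∑ α ∈ Finset.piAntidiag Finset.univ s, ENNReal.ofReal (1 / ∏ j, ((α j).factorial : ℝ)) *
          ∫⁻ ξ, ‖derivSymbol α ξ * u ξ‖ₑ ^ 2 := hu.lintegral_derivEnergy s
    _ = ∫⁻ ξ, ENNReal.ofReal ((2 * Real.pi * ‖ξ‖) ^ (2 * s) / (s.factorial : ℝ)) *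
          ‖u ξ‖ₑ ^ 2 := by
        simp only [← sum_enorm_derivSymbol_sq, Finset.sum_mul]
        rw [lintegral_finsetSum']
        · refine Finset.sum_congr rfl fun α _ => ?_
          rw [← lintegral_const_mul' _ _ ENNReal.ofReal_ne_top]
          simp only [enorm_mul, mul_pow, mul_assoc]
        · intro α _
          simp only [mul_assoc, ← mul_pow, ← enorm_mul]
          exact (hmeas α).const_mul _
    _ ≤ ∫⁻ ξ, ENNReal.ofReal (m ^ (2 * s) / (s.factorial : ℝ)) * ‖u ξ‖ₑ ^ 2 := by
        refine lintegral_mono_ae (hu.vanish.mono fun ξ hξ => ?_)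
        by_cases h : m < 2 * Real.pi * ‖ξ‖
        · simp [hξ h]
        · rw [not_lt] at h
          gcongr
    _ = _ := lintegral_const_mul' _ _ ENNReal.ofReal_ne_top

theorem enorm_sq_taylorTerm_le (u : EuclideanSpace ℝ (Fin d) → ℂ) (s : ℕ)
    (x e : EuclideanSpace ℝ (Fin d)) :
    ‖taylorTerm u s x e‖ₑ ^ 2 ≤
      ENNReal.ofReal (‖e‖ ^ (2 * s) / (s.factorial : ℝ)) * derivEnergy u s x := by
  have h := sum_pow_div_factorial (fun j => (e j) ^ 2) s
  have h1 : ∑ j, (e j) ^ 2 = ‖e‖ ^ 2 := by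
    simp only [EuclideanSpace.norm_sq_eq, Real.norm_eq_abs, sq_abs]
  rw [h1, ← pow_mul] at h
  have hnn : ∀ α ∈ (Finset.piAntidiag Finset.univ s : Finset (Fin d → ℕ)),
      0 ≤ (∏ j, (e j ^ 2) ^ α j) / ∏ j, ((α j).factorial : ℝ) := fun α _ =>
    div_nonneg (Finset.prod_nonneg fun j _ => by positivity) (by positivity)
  rw [h, ENNReal.ofReal_sum_of_nonneg hnn, derivEnergy, taylorTerm]
  refine (pow_le_pow_left₀ zero_le (enorm_sum_le _ _) 2).trans
    (ennreal_sq_sum_le_mul_of_sq_le_mul _ fun α hα => ?_)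
  · have hnn' := hnn α hα
    rw [enorm_mul, mul_pow, ← mul_assoc]
    refine mul_le_mul_left (le_of_eq ?_) _
    rw [← ofReal_norm, ← ENNReal.ofReal_pow (norm_nonneg _), ← ENNReal.ofReal_mul hnn']
    congr 1
    rw [Complex.norm_real, Real.norm_eq_abs, sq_abs, div_pow, ← Finset.prod_pow]
    simp only [← pow_mul, mul_comm]
    field_simp

/-- Translation by `e` multiplies the spectrum by `exp(2πi⟨ξ,e⟩)`. Expanding this exponential under
the integral is allowed because the `s`-th term has `L¹` norm at most `(|m|‖e‖)^s/s! · ‖u‖₁`. -/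
theorem BandSpectrum.hasSum_taylorTerm {m : ℝ} {u : EuclideanSpace ℝ (Fin d) → ℂ}
    (hu : BandSpectrum m u) (x e : EuclideanSpace ℝ (Fin d)) :
    HasSum (fun s => taylorTerm u s x e) (𝓕⁻ u (x + e)) := by
  set G : ℕ → EuclideanSpace ℝ (Fin d) → ℂ := fun s ξ =>
    Complex.exp (↑(2 * Real.pi * inner ℝ ξ x) * Complex.I) •
      ((2 * Real.pi * Complex.I * (inner ℝ ξ e : ℝ)) ^ s / (s.factorial : ℂ) * u ξ) with hG
  have hexpc : Continuous fun ξ : EuclideanSpace ℝ (Fin d) =>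
      Complex.exp (↑(2 * Real.pi * inner ℝ ξ x) * Complex.I) := by fun_prop
  have hband : ∀ s, BandSpectrum m
      (fun ξ => (2 * Real.pi * Complex.I * (inner ℝ ξ e : ℝ)) ^ s / (s.factorial : ℂ) * u ξ) :=
    fun s => hu.mul_continuous (by fun_prop)
  have hnormG : ∀ s ξ, ‖G s ξ‖ =
      ‖(2 * Real.pi * Complex.I * (inner ℝ ξ e : ℝ)) ^ s / (s.factorial : ℂ) * u ξ‖ := by
    intro s ξ
    simp only [hG, norm_smul, Complex.norm_exp_ofReal_mul_I, one_mul]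
  have hint : ∀ s, Integrable (G s) := fun s => by
    refine (hband s).integrable.mono ?_ (Filter.Eventually.of_forall fun ξ => (hnormG s ξ).le)
    exact hexpc.aestronglyMeasurable.smul (hband s).memLp.1
  have hterm : ∀ s, ∫ ξ, G s ξ = taylorTerm u s x e := by
    intro s
    have hexp : ∀ ξ : EuclideanSpace ℝ (Fin d),
        (2 * Real.pi * Complex.I * (inner ℝ ξ e : ℝ)) ^ s / (s.factorial : ℂ) =
        ∑ α ∈ Finset.piAntidiag Finset.univ s,
          (((∏ j, e j ^ α j) / ∏ j, ((α j).factorial : ℝ) : ℝ) : ℂ) * derivSymbol α ξ := by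
      intro ξ
      have : 2 * Real.pi * Complex.I * (inner ℝ ξ e : ℝ) =
          ∑ j, (e j : ℂ) * (2 * Real.pi * Complex.I * (ξ j : ℝ)) := by
        simp only [PiLp.inner_apply, RCLike.inner_apply, conj_trivial, Complex.ofReal_sum,
          Complex.ofReal_mul, Finset.mul_sum]
        exact Finset.sum_congr rfl fun j _ => by ring
      rw [this, sum_pow_div_factorial]
      refine Finset.sum_congr rfl fun α _ => ?_
      simp only [mul_pow, Finset.prod_mul_distrib, derivSymbol]
      push_cast
      ring
    simp only [hG, hexp]
    simp only [Finset.sum_mul, Finset.smul_sum]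
    rw [integral_finsetSum]
    · refine Finset.sum_congr rfl fun α _ => ?_
      rw [Real.fourierInv_eq', ← integral_const_mul]
      congr 1
      ext ξ
      simp only [smul_eq_mul]
      ring
    · intro α _
      have hb : BandSpectrum m (fun ξ => (((∏ j, e j ^ α j) / ∏ j, ((α j).factorial : ℝ) : ℝ) : ℂ) *
          derivSymbol α ξ * u ξ) :=
        hu.mul_continuous (continuous_const.mul (continuous_derivSymbol α))
      refine hb.integrable.mono ?_ (Filter.Eventually.of_forall fun ξ => ?_)
      · exact hexpc.aestronglyMeasurable.smul hb.memLp.1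
      · simp only [norm_smul, Complex.norm_exp_ofReal_mul_I, one_mul]; rfl
  have hval : ∀ ξ, HasSum (fun s => G s ξ)
      (Complex.exp (↑(2 * Real.pi * inner ℝ ξ x) * Complex.I) •
        (Complex.exp (2 * Real.pi * Complex.I * (inner ℝ ξ e : ℝ)) * u ξ)) := by
    intro ξ
    refine HasSum.const_smul _ (HasSum.mul_right _ ?_)
    rw [Complex.exp_eq_exp_ℂ]
    exact NormedSpace.expSeries_div_hasSum_exp _
  have hsum : Summable fun s => ∫ ξ, ‖G s ξ‖ := by
    refine Summable.of_nonneg_of_le (fun s => integral_nonneg fun ξ => norm_nonneg _) (fun s => ?_)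
      ((Real.summable_pow_div_factorial (|m| * ‖e‖)).mul_right (∫ ξ, ‖u ξ‖))
    rw [← integral_const_mul]
    refine integral_mono_ae (hint s).norm (hu.integrable.norm.const_mul _) ?_
    filter_upwards [hu.vanish] with ξ hξ
    simp only [hnormG]
    by_cases h : m < 2 * Real.pi * ‖ξ‖
    · simp [hξ h]
    · rw [not_lt] at h
      simp only [norm_mul, norm_div, norm_pow, Complex.norm_real, Complex.norm_I, Complex.norm_ofNat,
        Real.norm_eq_abs, abs_of_pos Real.pi_pos, mul_one, Complex.norm_natCast]
      gcongr ?_ ^ s / _ * _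
      calc 2 * Real.pi * |inner ℝ ξ e| ≤ 2 * Real.pi * (‖ξ‖ * ‖e‖) := by
            gcongr; exact abs_real_inner_le_norm ξ e
        _ = (2 * Real.pi * ‖ξ‖) * ‖e‖ := by ring
        _ ≤ |m| * ‖e‖ := by gcongr; exact h.trans (le_abs_self m)
  have key := hasSum_integral_of_summable_integral_norm hint hsum
  simp only [hterm, fun ξ => (hval ξ).tsum_eq] at key
  rwa [fourierInv_add_eq, Real.fourierInv_eq']

/-- Cauchy–Schwarz over the orders `s ≥ K`, splitting `ρ^{2s}/s!` as `(mρ)^s/s!` times `(ρ/m)^s`.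
The case `K = 0` bounds the function value itself. -/
theorem BandSpectrum.enorm_sq_sub_taylor_le {m : ℝ} (hm : 0 < m)
    {u : EuclideanSpace ℝ (Fin d) → ℂ} (hu : BandSpectrum m u) (K : ℕ) {ρ : ℝ}
    (x e : EuclideanSpace ℝ (Fin d)) (he : ‖e‖ ≤ ρ) :
    ‖𝓕⁻ u (x + e) - ∑ s ∈ Finset.range K, taylorTerm u s x e‖ₑ ^ 2 ≤
      expTail K (m * ρ) *
        ∑' i : ℕ, ENNReal.ofReal ((ρ / m) ^ (i + K)) * derivEnergy u (i + K) x := by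
  have hρ : 0 ≤ ρ := (norm_nonneg e).trans he
  have h := (hasSum_nat_add_iff' K).2 (hu.hasSum_taylorTerm x e)
  rw [← h.tsum_eq]
  refine le_trans (pow_le_pow_left₀ (zero_le) (enorm_tsum_le_tsum_enorm) 2)
    (ennreal_sq_tsum_le_mul_of_sq_le_mul fun i => ?_)
  refine (enorm_sq_taylorTerm_le u (i + K) x e).trans ?_
  rw [← mul_assoc, ← ENNReal.ofReal_mul (by positivity)]
  refine mul_le_mul_left (ENNReal.ofReal_le_ofReal ?_) _
  calc ‖e‖ ^ (2 * (i + K)) / ((i + K).factorial : ℝ)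
      ≤ ρ ^ (2 * (i + K)) / ((i + K).factorial : ℝ) := by gcongr
    _ = _ := by
      rw [mul_pow, div_pow, pow_mul']
      field_simp

end DerivativeSampling

namespace DerivativeSampling

variable {d : ℕ} {ι : Type*}

/-! ### Sampling on a partition into small cells -/

/-- The measurable sets `V n` partition the space up to null sets, and `V n` lies within distance
`ρ` of `x n`. -/
structure CellPartition (V : ι → Set (EuclideanSpace ℝ (Fin d)))
    (x : ι → EuclideanSpace ℝ (Fin d)) (ρ : ℝ) : Prop where
  measurableSet : ∀ n, MeasurableSet (V n)
  existsUnique : ∀ᵐ y, ∃! n, y ∈ V n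
  norm_sub_node_le : ∀ n, ∀ y ∈ V n, ‖y - x n‖ ≤ ρ

variable {V : ι → Set (EuclideanSpace ℝ (Fin d))} {x : ι → EuclideanSpace ℝ (Fin d)} {ρ : ℝ}

theorem CellPartition.tsum_indicator (hV : CellPartition V x ρ)
    (f : EuclideanSpace ℝ (Fin d) → ℝ≥0∞) : ∀ᵐ y, ∑' n, (V n).indicator f y = f y := by
  filter_upwards [hV.existsUnique] with y ⟨n, hn, hu⟩
  rw [tsum_eq_single n, indicator_of_mem hn]
  intro n' hn'
  exact indicator_of_notMem (fun h => hn' (hu n' h)) _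

theorem CellPartition.tsum_setLIntegral [Countable ι] (hV : CellPartition V x ρ)
    {f : EuclideanSpace ℝ (Fin d) → ℝ≥0∞} (hf : AEMeasurable f) :
    ∑' n, ∫⁻ y in V n, f y = ∫⁻ y, f y := by
  simp only [← lintegral_indicator (hV.measurableSet _)]
  rw [← lintegral_tsum fun n => hf.indicator (hV.measurableSet n)]
  exact lintegral_congr_ae (hV.tsum_indicator f)

/-- A pointwise majorant of `|𝓕⁻ w|²` on the ball of radius `ρ` around `y`. -/
noncomputable def localMajorant (m ρ : ℝ) (w : EuclideanSpace ℝ (Fin d) → ℂ)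
    (y : EuclideanSpace ℝ (Fin d)) : ℝ≥0∞ :=
  expTail 0 (m * ρ) * ∑' i : ℕ, ENNReal.ofReal ((ρ / m) ^ i) * derivEnergy w i y

theorem BandSpectrum.measurable_localMajorant {R : ℝ} {w : EuclideanSpace ℝ (Fin d) → ℂ}
    (hw : BandSpectrum R w) (m ρ : ℝ) : Measurable (localMajorant m ρ w) :=
  (Measurable.tsum fun i => (hw.measurable_derivEnergy i).const_mul _).const_mul _

theorem BandSpectrum.enorm_sq_le_localMajorant {m : ℝ} (hm : 0 < m)
    {w : EuclideanSpace ℝ (Fin d) → ℂ} (hw : BandSpectrum m w) {ρ : ℝ}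
    {y z : EuclideanSpace ℝ (Fin d)} (hyz : ‖z - y‖ ≤ ρ) :
    ‖𝓕⁻ w z‖ₑ ^ 2 ≤ localMajorant m ρ w y := by
  have h := hw.enorm_sq_sub_taylor_le hm 0 y (z - y) hyz
  simpa [localMajorant] using h

theorem BandSpectrum.lintegral_localMajorant_le {m : ℝ} (hm : 0 < m)
    {w : EuclideanSpace ℝ (Fin d) → ℂ} (hw : BandSpectrum m w) {ρ : ℝ} (hρ : 0 ≤ ρ) :
    ∫⁻ y, localMajorant m ρ w y ≤
      ENNReal.ofReal (Real.exp (2 * (m * ρ))) * ∫⁻ ξ, ‖w ξ‖ₑ ^ 2 := by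
  have hz : 0 ≤ m * ρ := by positivity
  unfold localMajorant
  rw [lintegral_const_mul _ (Measurable.tsum fun i =>
    (hw.measurable_derivEnergy i).const_mul _),
    lintegral_tsum fun i => ((hw.measurable_derivEnergy i).const_mul _).aemeasurable]
  calc expTail 0 (m * ρ) * ∑' i : ℕ, ∫⁻ y, ENNReal.ofReal ((ρ / m) ^ i) * derivEnergy w i y
      ≤ expTail 0 (m * ρ) * ∑' i : ℕ, ENNReal.ofReal ((ρ / m) ^ (i + 0)) *
          ENNReal.ofReal (m ^ (2 * (i + 0)) / ((i + 0).factorial : ℝ)) * ∫⁻ ξ, ‖w ξ‖ₑ ^ 2 := by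
        gcongr with i
        rw [lintegral_const_mul' _ _ ENNReal.ofReal_ne_top, mul_assoc]
        exact mul_le_mul_right (hw.lintegral_derivEnergy_le i) _
    _ = _ := by
        rw [ENNReal.tsum_mul_right, expTail_eq_weighted 0 hm hρ, ← mul_assoc, expTail_zero hz,
          ← ENNReal.ofReal_mul (Real.exp_nonneg _), ← Real.exp_add, two_mul]

/-- The values of band-limited functions at the nodes, weighted by the volumes of the cells, are
square summable with a bound `κ`. -/
def SampleBound (V : ι → Set (EuclideanSpace ℝ (Fin d))) (x : ι → EuclideanSpace ℝ (Fin d))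
    (m κ : ℝ) : Prop :=
  ∀ w : EuclideanSpace ℝ (Fin d) → ℂ, BandSpectrum m w →
    ∑' n, volume (V n) * ‖𝓕⁻ w (x n)‖ₑ ^ 2 ≤ ENNReal.ofReal κ * ∫⁻ ξ, ‖w ξ‖ₑ ^ 2

/-- Each `y ∈ V_n` has `x_n` within distance `ρ`, so the majorant at `y` dominates `|𝓕⁻ w(x_n)|²`.
Integrating over `V_n` and summing costs only the integral of the majorant. -/
theorem CellPartition.sampleBound_exp [Countable ι] (hV : CellPartition V x ρ) (hρ : 0 ≤ ρ)
    {m : ℝ} (hm : 0 < m) : SampleBound V x m (Real.exp (2 * (m * ρ))) := by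
  intro w hw
  refine le_trans ?_ (hw.lintegral_localMajorant_le hm hρ)
  rw [← hV.tsum_setLIntegral (hw.measurable_localMajorant m ρ).aemeasurable]
  refine ENNReal.tsum_le_tsum fun n => ?_
  rw [mul_comm, ← setLIntegral_const]
  refine setLIntegral_mono (hw.measurable_localMajorant m ρ) fun y hy => ?_
  refine hw.enorm_sq_le_localMajorant hm ?_
  rw [norm_sub_rev]
  exact hV.norm_sub_node_le n y hy

/-- Comparison over a ball of free radius `r` about the node in place of the cell. A smaller `r`
lowers the exponential factor but increases the weighted overlap of the balls, which is measured by
`(1 + ρ/r)^d`. -/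
theorem CellPartition.sampleBound_ball [Countable ι] (hV : CellPartition V x ρ) (hρ : 0 ≤ ρ)
    {m : ℝ} (hm : 0 < m) {r : ℝ} (hr : 0 < r) :
    SampleBound V x m ((1 + ρ / r) ^ d * Real.exp (2 * (m * r))) := by
  intro w hw
  set E := localMajorant m r w with hE
  have hEm : Measurable E := hw.measurable_localMajorant m r
  set β := volume (Metric.closedBall (0 : EuclideanSpace ℝ (Fin d)) r) with hβ
  have hvol : ∀ (y : EuclideanSpace ℝ (Fin d)) (s : ℝ), 0 ≤ s →
      volume (Metric.closedBall y s) = ENNReal.ofReal (s ^ d) *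
        volume (Metric.ball (0 : EuclideanSpace ℝ (Fin d)) 1) := fun y s hs => by
    rw [Measure.addHaar_closedBall _ _ hs, finrank_euclideanSpace_fin]
  have hβ0 : β ≠ 0 := (Metric.measure_closedBall_pos _ _ hr).ne'
  have hβt : β ≠ ⊤ := (isCompact_closedBall _ _).measure_lt_top.ne
  -- If `y` is within `r` of `x_n`, then `V_n` lies in the ball of radius `r + ρ` about `y`. The
  -- cells are almost disjoint, so their total volume is at most that of this ball.
  have hcount : ∀ y, ∑' n, volume (V n) * (Metric.closedBall (x n) r).indicator 1 y ≤
      ENNReal.ofReal ((1 + ρ / r) ^ d) * β := by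
    intro y
    calc ∑' n, volume (V n) * (Metric.closedBall (x n) r).indicator 1 y
        ≤ ∑' n, ∫⁻ z in V n, (Metric.closedBall y (r + ρ)).indicator 1 z := by
          refine ENNReal.tsum_le_tsum fun n => ?_
          by_cases hy : y ∈ Metric.closedBall (x n) r
          · rw [indicator_of_mem hy, Pi.one_apply, mul_one, ← setLIntegral_one]
            refine setLIntegral_mono (measurable_one.indicator measurableSet_closedBall)
              fun z hz => ?_
            rw [indicator_of_mem, Pi.one_apply]
            rw [mem_closedBall_iff_norm] at hy ⊢
            have h1 := hV.norm_sub_node_le n z hz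
            calc ‖z - y‖ = ‖(z - x n) - (y - x n)‖ := by congr 1; abel
              _ ≤ ‖z - x n‖ + ‖y - x n‖ := norm_sub_le _ _
              _ ≤ r + ρ := by linarith
          · rw [indicator_of_notMem hy, mul_zero]; exact zero_le
      _ = volume (Metric.closedBall y (r + ρ)) := by
          rw [hV.tsum_setLIntegral (measurable_one.indicator measurableSet_closedBall).aemeasurable,
            lintegral_indicator_one measurableSet_closedBall]
      _ = _ := by
          rw [hvol y _ (by positivity), hβ, hvol 0 r hr.le, ← mul_assoc,
            ← ENNReal.ofReal_mul (by positivity), ← mul_pow]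
          congr 3
          field_simp
  have key : β * ∑' n, volume (V n) * ‖𝓕⁻ w (x n)‖ₑ ^ 2 ≤
      β * (ENNReal.ofReal ((1 + ρ / r) ^ d) * ∫⁻ y, E y) := by
    calc β * ∑' n, volume (V n) * ‖𝓕⁻ w (x n)‖ₑ ^ 2
        ≤ ∑' n, ∫⁻ y, volume (V n) * (Metric.closedBall (x n) r).indicator 1 y * E y := by
          rw [← ENNReal.tsum_mul_left]
          refine ENNReal.tsum_le_tsum fun n => ?_
          have h1 : β * ‖𝓕⁻ w (x n)‖ₑ ^ 2 ≤ ∫⁻ y in Metric.closedBall (x n) r, E y := by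
            have : β = volume (Metric.closedBall (x n) r) := by
              rw [hβ, hvol 0 r hr.le, hvol (x n) r hr.le]
            rw [this, mul_comm, ← setLIntegral_const]
            refine setLIntegral_mono hEm fun y hy => hw.enorm_sq_le_localMajorant hm ?_
            rwa [mem_closedBall_iff_norm, norm_sub_rev] at hy
          simp only [mul_assoc]
          have hm' : Measurable fun y => (Metric.closedBall (x n) r).indicator 1 y * E y :=
            (measurable_one.indicator measurableSet_closedBall).mul hEm
          rw [lintegral_const_mul _ hm', mul_left_comm]
          gcongr
          refine h1.trans (le_of_eq ?_)
          rw [← lintegral_indicator measurableSet_closedBall]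
          congr 1
          ext y
          by_cases hy : y ∈ Metric.closedBall (x n) r <;> simp [hy]
      _ = ∫⁻ y, (∑' n, volume (V n) * (Metric.closedBall (x n) r).indicator 1 y) * E y := by
          rw [← lintegral_tsum]
          · simp only [ENNReal.tsum_mul_right]
          · exact fun n => (((measurable_one.indicator measurableSet_closedBall).const_mul _).mul
              hEm).aemeasurable
      _ ≤ ∫⁻ y, ENNReal.ofReal ((1 + ρ / r) ^ d) * β * E y := by
          gcongr with y
          exact hcount y
      _ = _ := by
          rw [lintegral_const_mul _ hEm]
          ring
  rw [ENNReal.mul_le_mul_iff_right hβ0 hβt] at key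
  refine key.trans ?_
  rw [ENNReal.ofReal_mul (by positivity), mul_assoc]
  gcongr
  exact hw.lintegral_localMajorant_le hm hr.le

/-- Multiplication by `derivSymbol α` keeps the spectrum in the same band, so the bound for values
applies to each derivative separately; the Bernstein bound then controls their sum. -/
theorem SampleBound.tsum_derivEnergy_le {m κ : ℝ} (hκ : SampleBound V x m κ)
    {u : EuclideanSpace ℝ (Fin d) → ℂ} (hu : BandSpectrum m u) (s : ℕ) :
    ∑' n, volume (V n) * derivEnergy u s (x n) ≤
      ENNReal.ofReal κ * (ENNReal.ofReal (m ^ (2 * s) / (s.factorial : ℝ)) *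
        ∫⁻ ξ, ‖u ξ‖ₑ ^ 2) := by
  refine le_trans ?_ (mul_le_mul_right (hu.lintegral_derivEnergy_le s) _)
  rw [hu.lintegral_derivEnergy s]
  simp only [derivEnergy, Finset.mul_sum]
  rw [Summable.tsum_finsetSum fun _ _ => ENNReal.summable]
  refine Finset.sum_le_sum fun α _ => ?_
  simp only [mul_left_comm (volume _)]
  rw [ENNReal.tsum_mul_left, mul_left_comm]
  gcongr
  exact hκ _ (hu.derivSymbol_mul α)

/-- The weight `(1/α!) ∫_{V n} (y - x n)^{2α} dy` as an extended number. -/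
noncomputable def cellMoment (V : ι → Set (EuclideanSpace ℝ (Fin d)))
    (x : ι → EuclideanSpace ℝ (Fin d)) (n : ι) (α : Fin d → ℕ) : ℝ≥0∞ :=
  ENNReal.ofReal (1 / ∏ j, ((α j).factorial : ℝ)) *
    ∫⁻ y in V n, ENNReal.ofReal (∏ j, (y j - x n j) ^ (2 * α j))

/-- The sum of the weighted squared samples of the derivatives of `𝓕⁻ u` at the node `x n`. -/
noncomputable def sampleEnergy (V : ι → Set (EuclideanSpace ℝ (Fin d)))
    (x : ι → EuclideanSpace ℝ (Fin d)) (k : ℕ) (u : EuclideanSpace ℝ (Fin d) → ℂ) (n : ι) : ℝ≥0∞ :=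
  ∑ α ∈ multiIndices d k, cellMoment V x n α * ‖𝓕⁻ (fun ξ => derivSymbol α ξ * u ξ) (x n)‖ₑ ^ 2

theorem sum_multiIndices {M : Type*} [AddCommMonoid M] (k : ℕ) (f : (Fin d → ℕ) → M) :
    ∑ α ∈ multiIndices d k, f α =
      ∑ s ∈ Finset.range (k + 1), ∑ α ∈ Finset.piAntidiag Finset.univ s, f α := by
  rw [Finset.sum_sigma']
  refine Finset.sum_bij' (fun α _ => ⟨∑ j, α j, α⟩) (fun p _ => p.2) ?_ ?_ ?_ ?_ ?_
  · intro α hα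
    simpa [Nat.lt_succ_iff] using mem_multiIndices.1 hα
  · rintro ⟨s, α⟩ h
    simp only [Finset.mem_sigma, Finset.mem_range, Finset.mem_piAntidiag] at h
    obtain ⟨hs, rfl, -⟩ := h
    exact mem_multiIndices.2 (Nat.lt_succ_iff.1 hs)
  · intro α _; rfl
  · rintro ⟨s, α⟩ h
    simp only [Finset.mem_sigma, Finset.mem_range, Finset.mem_piAntidiag] at h
    obtain ⟨-, rfl, -⟩ := h
    rfl
  · intro α _; rfl

theorem prod_pow_two_mul_le (e : EuclideanSpace ℝ (Fin d)) {ρ : ℝ} (he : ‖e‖ ≤ ρ)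
    (α : Fin d → ℕ) : ∏ j, e j ^ (2 * α j) ≤ ρ ^ (2 * ∑ j, α j) := by
  rw [Finset.mul_sum, ← Finset.prod_pow_eq_pow_sum]
  refine Finset.prod_le_prod (fun j _ => (even_two_mul _).pow_nonneg _) fun j _ => ?_
  rw [← (even_two_mul (α j)).pow_abs]
  gcongr
  exact (PiLp.norm_apply_le e j).trans he

theorem CellPartition.sampleEnergy_le (hV : CellPartition V x ρ) (k : ℕ)
    (u : EuclideanSpace ℝ (Fin d) → ℂ) (n : ι) :
    sampleEnergy V x k u n ≤ ∑ s ∈ Finset.range (k + 1),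
      ENNReal.ofReal (ρ ^ (2 * s)) * (volume (V n) * derivEnergy u s (x n)) := by
  rw [sampleEnergy, sum_multiIndices]
  refine Finset.sum_le_sum fun s _ => ?_
  rw [derivEnergy, Finset.mul_sum, Finset.mul_sum]
  refine Finset.sum_le_sum fun α hα => ?_
  obtain ⟨rfl, -⟩ := Finset.mem_piAntidiag.1 hα
  rw [cellMoment, ← mul_assoc, ← mul_assoc, mul_comm (_ * volume _)]
  refine mul_le_mul_left (mul_le_mul_right ?_ _) _
  rw [← setLIntegral_const]
  refine setLIntegral_mono measurable_const fun y hy => ENNReal.ofReal_le_ofReal ?_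
  exact prod_pow_two_mul_le (y - x n) (hV.norm_sub_node_le n y hy) α

/-- On a cell `|(y - x_n)^{2α}| ≤ ρ^{2|α|}`, so order `s` contributes at most `κ (mρ)^{2s}/s!`;
these terms are part of the series of `exp((mρ)²)`. -/
theorem CellPartition.tsum_sampleEnergy_le (hV : CellPartition V x ρ) (hρ : 0 ≤ ρ) {m κ : ℝ}
    (hκ : SampleBound V x m κ) {u : EuclideanSpace ℝ (Fin d) → ℂ}
    (hu : BandSpectrum m u) (k : ℕ) :
    ∑' n, sampleEnergy V x k u n ≤
      ENNReal.ofReal κ * ENNReal.ofReal (Real.exp ((m * ρ) ^ 2)) * ∫⁻ ξ, ‖u ξ‖ₑ ^ 2 := by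
  calc ∑' n, sampleEnergy V x k u n
      ≤ ∑ s ∈ Finset.range (k + 1), ENNReal.ofReal (ρ ^ (2 * s)) *
          ∑' n, volume (V n) * derivEnergy u s (x n) := by
        refine (ENNReal.tsum_le_tsum (hV.sampleEnergy_le k u)).trans (le_of_eq ?_)
        rw [Summable.tsum_finsetSum fun _ _ => ENNReal.summable]
        simp only [ENNReal.tsum_mul_left]
    _ ≤ ∑ s ∈ Finset.range (k + 1), ENNReal.ofReal (((m * ρ) ^ 2) ^ s / (s.factorial : ℝ)) *
          (ENNReal.ofReal κ * ∫⁻ ξ, ‖u ξ‖ₑ ^ 2) := by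
        refine Finset.sum_le_sum fun s _ => ?_
        refine (mul_le_mul_right (hκ.tsum_derivEnergy_le hu s) _).trans (le_of_eq ?_)
        rw [mul_left_comm (ENNReal.ofReal κ), ← mul_assoc, ← ENNReal.ofReal_mul (by positivity)]
        congr 2
        rw [← pow_mul, mul_pow]
        ring
    _ ≤ _ := by
        rw [← Finset.sum_mul, mul_comm, mul_right_comm]
        gcongr
        rw [← ENNReal.ofReal_sum_of_nonneg fun s _ => by positivity]
        exact ENNReal.ofReal_le_ofReal (Real.sum_le_exp_of_nonneg (by positivity) _)

/-! ### Control of the norm by Taylor polynomials on the cells -/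

theorem sum_multiIndices_inv_factorial_le (k : ℕ) :
    ∑ α ∈ multiIndices d k, ENNReal.ofReal (1 / ∏ j, ((α j).factorial : ℝ)) ≤
      ENNReal.ofReal (Real.exp d) := by
  rw [← ENNReal.ofReal_sum_of_nonneg fun α _ => by positivity, sum_multiIndices]
  refine ENNReal.ofReal_le_ofReal
    (le_trans (le_of_eq ?_) (Real.sum_le_exp_of_nonneg (Nat.cast_nonneg d) (k + 1)))
  refine Finset.sum_congr rfl fun s _ => ?_
  simpa using (sum_pow_div_factorial (fun _ : Fin d => (1 : ℝ)) s).symm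

/-- Cauchy–Schwarz with weights `1/α!`, whose sum is at most `e^d`; this is the origin of the factor
`e^{-d}` in the lower frame bound. Integrated over a cell, the monomials `e^{2α}/α!` become the
sampling weights. -/
theorem enorm_sq_sum_taylorTerm_le (k : ℕ) (u : EuclideanSpace ℝ (Fin d) → ℂ)
    (x e : EuclideanSpace ℝ (Fin d)) :
    ‖∑ s ∈ Finset.range (k + 1), taylorTerm u s x e‖ₑ ^ 2 ≤
      ENNReal.ofReal (Real.exp d) * ∑ α ∈ multiIndices d k,
        ENNReal.ofReal (1 / ∏ j, ((α j).factorial : ℝ)) * ENNReal.ofReal (∏ j, e j ^ (2 * α j)) *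
          ‖𝓕⁻ (fun ξ => derivSymbol α ξ * u ξ) x‖ₑ ^ 2 := by
  simp only [taylorTerm]
  rw [← sum_multiIndices]
  refine le_trans ?_ (mul_le_mul_left (sum_multiIndices_inv_factorial_le k) _)
  refine (pow_le_pow_left₀ zero_le (enorm_sum_le _ _) 2).trans
    (ennreal_sq_sum_le_mul_of_sq_le_mul _ fun α hα => le_of_eq ?_)
  rw [enorm_mul, mul_pow, ← mul_assoc, ← mul_assoc]
  congr 1
  rw [← ofReal_norm, ← ENNReal.ofReal_pow (norm_nonneg _), ← ENNReal.ofReal_mul (by positivity),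
    ← ENNReal.ofReal_mul (by positivity)]
  congr 1
  rw [Complex.norm_real, Real.norm_eq_abs, sq_abs, div_pow, ← Finset.prod_pow]
  simp only [← pow_mul, mul_comm]
  field_simp

theorem enorm_sq_le_add {q : ℝ} (hq0 : 0 < q) (hq1 : q < 1) (a b : ℂ) :
    ‖a‖ₑ ^ 2 ≤ ENNReal.ofReal (1 / q) * ‖a - b‖ₑ ^ 2 + ENNReal.ofReal (1 / (1 - q)) * ‖b‖ₑ ^ 2 := by
  have h1 : 0 < 1 - q := by linarith
  simp only [← ofReal_norm, ← ENNReal.ofReal_pow (norm_nonneg _)]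
  rw [← ENNReal.ofReal_mul (by positivity), ← ENNReal.ofReal_mul (by positivity),
    ← ENNReal.ofReal_add (by positivity) (by positivity)]
  refine ENNReal.ofReal_le_ofReal ?_
  have h2 : ‖a‖ ≤ ‖a - b‖ + ‖b‖ := by simpa using norm_add_le (a - b) b
  set s := ‖a - b‖
  set t := ‖b‖
  have h3 : ‖a‖ ^ 2 ≤ (s + t) ^ 2 := by gcongr
  refine h3.trans ?_
  rw [one_div_mul_eq_div, one_div_mul_eq_div, div_add_div _ _ hq0.ne' h1.ne',
    le_div_iff₀ (by positivity)]
  -- After clearing denominators, the difference of the two sides is exactly this square.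
  nlinarith [sq_nonneg ((1 - q) * s - q * t)]

/-- On each cell `𝓕⁻ u` is split into Taylor polynomial and remainder. The parameter `q` replaces
the triangle inequality in `L²` by an inequality between squares, so that it can be summed cell by
cell. -/
theorem CellPartition.lintegral_enorm_sq_le [Countable ι] (hV : CellPartition V x ρ) (hρ : 0 ≤ ρ)
    {m κ : ℝ} (hm : 0 < m) (hκ : SampleBound V x m κ) {u : EuclideanSpace ℝ (Fin d) → ℂ}
    (hu : BandSpectrum m u) (k : ℕ) {q : ℝ} (hq0 : 0 < q) (hq1 : q < 1) :
    ∫⁻ ξ, ‖u ξ‖ₑ ^ 2 ≤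
      ENNReal.ofReal (1 / q) * (ENNReal.ofReal κ * expTail (k + 1) (m * ρ) ^ 2 *
          ∫⁻ ξ, ‖u ξ‖ₑ ^ 2) +
        ENNReal.ofReal (1 / (1 - q)) * (ENNReal.ofReal (Real.exp d) *
          ∑' n, sampleEnergy V x k u n) := by
  have hFm : Measurable (𝓕⁻ u) := (continuous_fourierInv hu.integrable).measurable
  set P : ι → EuclideanSpace ℝ (Fin d) → ℂ := fun n y =>
    ∑ s ∈ Finset.range (k + 1), taylorTerm u s (x n) (y - x n) with hP
  have hPm : ∀ n, Measurable (P n) := fun n => by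
    refine Continuous.measurable ?_
    simp only [hP, taylorTerm, PiLp.sub_apply]
    fun_prop
  have h1 : ∑' n, ∫⁻ y in V n, ‖𝓕⁻ u y - P n y‖ₑ ^ 2 ≤
      ENNReal.ofReal κ * expTail (k + 1) (m * ρ) ^ 2 * ∫⁻ ξ, ‖u ξ‖ₑ ^ 2 := by
    calc ∑' n, ∫⁻ y in V n, ‖𝓕⁻ u y - P n y‖ₑ ^ 2
        ≤ ∑' n, (expTail (k + 1) (m * ρ) * ∑' i : ℕ, ENNReal.ofReal ((ρ / m) ^ (i + (k + 1))) *
            derivEnergy u (i + (k + 1)) (x n)) * volume (V n) := by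
          refine ENNReal.tsum_le_tsum fun n => ?_
          rw [← setLIntegral_const]
          refine setLIntegral_mono measurable_const fun y hy => ?_
          have := hu.enorm_sq_sub_taylor_le hm (k + 1) (x n) (y - x n) (hV.norm_sub_node_le n y hy)
          rwa [add_sub_cancel] at this
      _ = expTail (k + 1) (m * ρ) * ∑' i : ℕ, ENNReal.ofReal ((ρ / m) ^ (i + (k + 1))) *
            ∑' n, volume (V n) * derivEnergy u (i + (k + 1)) (x n) := by
          simp only [mul_assoc, ENNReal.tsum_mul_left, ← ENNReal.tsum_mul_right]
          rw [ENNReal.tsum_comm]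
          simp only [← ENNReal.tsum_mul_left, mul_comm]
      _ ≤ expTail (k + 1) (m * ρ) * ∑' i : ℕ, ENNReal.ofReal ((ρ / m) ^ (i + (k + 1))) *
            (ENNReal.ofReal κ * (ENNReal.ofReal (m ^ (2 * (i + (k + 1))) /
              ((i + (k + 1)).factorial : ℝ)) * ∫⁻ ξ, ‖u ξ‖ₑ ^ 2)) := by
          gcongr with i
          exact hκ.tsum_derivEnergy_le hu _
      _ = expTail (k + 1) (m * ρ) * (∑' i : ℕ, ENNReal.ofReal ((ρ / m) ^ (i + (k + 1))) *
            ENNReal.ofReal (m ^ (2 * (i + (k + 1))) /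
              ((i + (k + 1)).factorial : ℝ))) * (ENNReal.ofReal κ * ∫⁻ ξ, ‖u ξ‖ₑ ^ 2) := by
          rw [mul_assoc, ← ENNReal.tsum_mul_right]
          congr 2
          ext i
          ring
      _ = _ := by
          rw [expTail_eq_weighted _ hm hρ]
          ring
  have h2 : ∑' n, ∫⁻ y in V n, ‖P n y‖ₑ ^ 2 ≤
      ENNReal.ofReal (Real.exp d) * ∑' n, sampleEnergy V x k u n := by
    rw [← ENNReal.tsum_mul_left]
    refine ENNReal.tsum_le_tsum fun n => ?_
    calc ∫⁻ y in V n, ‖P n y‖ₑ ^ 2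
        ≤ ∫⁻ y in V n, ENNReal.ofReal (Real.exp d) * ∑ α ∈ multiIndices d k,
        ENNReal.ofReal (1 / ∏ j, ((α j).factorial : ℝ)) *
          ENNReal.ofReal (∏ j, (y - x n) j ^ (2 * α j)) *
          ‖𝓕⁻ (fun ξ => derivSymbol α ξ * u ξ) (x n)‖ₑ ^ 2 :=
          lintegral_mono fun y => enorm_sq_sum_taylorTerm_le k u (x n) (y - x n)
      _ = _ := by
          have hmono : ∀ α : Fin d → ℕ, Measurable fun y : EuclideanSpace ℝ (Fin d) =>
              ENNReal.ofReal (∏ j, (y - x n) j ^ (2 * α j)) := fun α => by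
            refine ENNReal.measurable_ofReal.comp (Continuous.measurable ?_)
            simp only [PiLp.sub_apply]
            fun_prop
          rw [lintegral_const_mul' _ _ ENNReal.ofReal_ne_top, sampleEnergy, lintegral_finsetSum]
          · congr 1
            refine Finset.sum_congr rfl fun α _ => ?_
            rw [lintegral_mul_const _ ((hmono α).const_mul _), lintegral_const_mul _ (hmono α)]
            rfl
          · exact fun α _ => ((hmono α).const_mul _).mul_const _
  calc ∫⁻ ξ, ‖u ξ‖ₑ ^ 2 = ∫⁻ y, ‖𝓕⁻ u y‖ₑ ^ 2 :=
        (lintegral_enorm_sq_fourierInv hu.memLp hu.integrable).symm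
    _ = ∑' n, ∫⁻ y in V n, ‖𝓕⁻ u y‖ₑ ^ 2 :=
        (hV.tsum_setLIntegral (hFm.enorm.pow_const 2).aemeasurable).symm
    _ ≤ ∑' n, ∫⁻ y in V n, (ENNReal.ofReal (1 / q) * ‖𝓕⁻ u y - P n y‖ₑ ^ 2 +
          ENNReal.ofReal (1 / (1 - q)) * ‖P n y‖ₑ ^ 2) := by
        gcongr with n y
        exact enorm_sq_le_add hq0 hq1 _ _
    _ = ENNReal.ofReal (1 / q) * (∑' n, ∫⁻ y in V n, ‖𝓕⁻ u y - P n y‖ₑ ^ 2) +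
          ENNReal.ofReal (1 / (1 - q)) * ∑' n, ∫⁻ y in V n, ‖P n y‖ₑ ^ 2 := by
        rw [← ENNReal.tsum_mul_left, ← ENNReal.tsum_mul_left, ← ENNReal.tsum_add]
        refine tsum_congr fun n => ?_
        have hm' : Measurable fun y => ENNReal.ofReal (1 / q) * ‖𝓕⁻ u y - P n y‖ₑ ^ 2 :=
          ((hFm.sub (hPm n)).enorm.pow_const 2).const_mul _
        rw [lintegral_add_left hm',
          lintegral_const_mul' _ _ ENNReal.ofReal_ne_top,
          lintegral_const_mul' _ _ ENNReal.ofReal_ne_top]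
    _ ≤ _ := by gcongr

end DerivativeSampling

namespace DerivativeSampling

/-! ### The constants of the density condition -/

theorem hasSum_expRemainder (k : ℕ) (z : ℝ) :
    HasSum (fun i : ℕ => z ^ (i + (k + 1)) / ((i + (k + 1)).factorial : ℝ)) (expRemainder k z) := by
  have h := (hasSum_nat_add_iff' (k + 1)).2 (NormedSpace.expSeries_div_hasSum_exp z)
  rwa [← Real.exp_eq_exp_ℝ] at h

theorem expRemainder_strictMonoOn (k : ℕ) : StrictMonoOn (expRemainder k) (Ici 0) := by
  intro a ha b _ hab
  rw [mem_Ici] at ha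
  refine hasSum_lt (i := 0) (fun i => ?_) ?_ (hasSum_expRemainder k a) (hasSum_expRemainder k b)
  · dsimp only
    gcongr
  · gcongr

theorem expRemainder_zero (k : ℕ) : expRemainder k 0 = 0 := by
  simp [expRemainder, Finset.sum_range_succ']

theorem expRemainder_nonneg (k : ℕ) {z : ℝ} (hz : 0 ≤ z) : 0 ≤ expRemainder k z := by
  rw [← expRemainder_zero k]
  exact (expRemainder_strictMonoOn k).monotoneOn self_mem_Ici hz hz

theorem continuous_expRemainder (k : ℕ) : Continuous (expRemainder k) := by
  unfold expRemainder; fun_prop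

theorem one_le_expRemainder (k : ℕ) : 1 ≤ expRemainder k ((k + 1).factorial : ℝ) := by
  have h1 : (1 : ℝ) ≤ ((k + 1).factorial : ℝ) := by exact_mod_cast Nat.factorial_pos (k + 1)
  have h := (hasSum_expRemainder k ((k + 1).factorial : ℝ)).summable.le_tsum 0
    fun i _ => by positivity
  rw [(hasSum_expRemainder k _).tsum_eq] at h
  refine le_trans ?_ h
  rw [zero_add, le_div_iff₀ (by positivity), one_mul]
  exact le_self_pow₀ h1 (by omega)

/-- Common to `h_k` and `g_{k,d}`: a monotone factor at least `1` times `R_k` is strictly increasing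
from `0`. The value of `Function.invFunOn` is meaningful only if `1` is attained, which the
intermediate value theorem gives on `[0, (k+1)!]`. -/
theorem mul_expRemainder_lt_one {k : ℕ} {K F : ℝ → ℝ} (hF : ∀ z, F z = K z * expRemainder k z)
    (hK1 : ∀ z, 0 ≤ z → 1 ≤ K z) (hmono : MonotoneOn K (Ici 0)) (hc : ContinuousOn K (Ici 0))
    {z : ℝ} (hz : 0 ≤ z) (hlt : z < Function.invFunOn F (Ioi 0) 1) : F z < 1 := by
  have hsm : StrictMonoOn F (Ici 0) := by
    intro a ha b hb hab
    rw [hF, hF]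
    have h1 := hmono ha hb hab.le
    have h2 := expRemainder_strictMonoOn k ha hb hab
    calc K a * expRemainder k a ≤ K b * expRemainder k a :=
          mul_le_mul_of_nonneg_right h1 (expRemainder_nonneg k ha)
      _ < K b * expRemainder k b :=
          mul_lt_mul_of_pos_left h2 (lt_of_lt_of_le one_pos (hK1 b hb))
  have hFc : ContinuousOn F (Ici 0) := by
    rw [funext hF]
    exact hc.mul (continuous_expRemainder k).continuousOn
  have h0 : F 0 = 0 := by rw [hF, expRemainder_zero, mul_zero]
  have hpos : (0 : ℝ) ≤ ((k + 1).factorial : ℝ) := by positivity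
  have h1 : 1 ≤ F ((k + 1).factorial : ℝ) := by
    rw [hF]
    exact one_le_mul_of_one_le_of_one_le (hK1 _ hpos) (one_le_expRemainder k)
  obtain ⟨c, hc, hFcval⟩ := intermediate_value_Icc hpos (hFc.mono Icc_subset_Ici_self)
    (show (1 : ℝ) ∈ Icc (F 0) (F ((k + 1).factorial : ℝ)) from ⟨h0.le.trans zero_le_one, h1⟩)
  have hcpos : 0 < c := lt_of_le_of_ne hc.1 fun h => by
    rw [← h, h0] at hFcval; exact zero_ne_one hFcval
  have hex : ∃ a ∈ Ioi (0 : ℝ), F a = 1 := ⟨c, hcpos, hFcval⟩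
  have hmem := Function.invFunOn_mem hex
  have heq := Function.invFunOn_eq hex
  rw [← heq]
  exact hsm hz (mem_Ici.2 (le_of_lt hmem)) hlt

theorem hFun_lt_one {k : ℕ} {z : ℝ} (hz : 0 ≤ z) (h : z < hInv k 1) : hFun k z < 1 :=
  mul_expRemainder_lt_one (k := k) (K := Real.exp) (fun _ => rfl)
    (fun _ hz => Real.one_le_exp hz) (Real.exp_monotone.monotoneOn _)
    Real.continuous_exp.continuousOn hz h

/-- Rationalising the quotient gives a form that is continuous at `0` and visibly monotone. At `z =
0` the convention `0 / 0 = 0` agrees with the limit. -/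
theorem div_sigmaStar {d : ℕ} (hd : 1 ≤ d) {z : ℝ} (hz : 0 ≤ z) :
    z / sigmaStar d z = Real.sqrt (z * (d + z)) - z := by
  have hd' : (0 : ℝ) < d := by exact_mod_cast hd
  rcases hz.eq_or_lt with rfl | hz
  · simp
  have hs := Real.sq_sqrt (show 0 ≤ z * (d + z) by positivity)
  have hs0 : 0 < z + Real.sqrt (z * (d + z)) := by positivity
  rw [sigmaStar, div_div_eq_mul_div, div_eq_iff hs0.ne']
  linear_combination -hs

theorem sigmaStar_nonneg (d : ℕ) {z : ℝ} (hz : 0 ≤ z) : 0 ≤ sigmaStar d z := by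
  unfold sigmaStar; positivity

theorem sigmaStar_pos {d : ℕ} (hd : 1 ≤ d) {z : ℝ} (hz : 0 < z) : 0 < sigmaStar d z := by
  have hd' : (0 : ℝ) < d := by exact_mod_cast hd
  unfold sigmaStar; positivity

theorem gFun_lt_one {k d : ℕ} (hd : 1 ≤ d) {z : ℝ} (hz : 0 ≤ z) (h : z < gInv k d 1) :
    gFun k d z < 1 := by
  have hd' : (0 : ℝ) < d := by exact_mod_cast hd
  have hK : EqOn (fun z => (1 + 2 * sigmaStar d z) ^ ((d : ℝ) / 2) * Real.exp (z / sigmaStar d z))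
      (fun z => (1 + 2 * sigmaStar d z) ^ ((d : ℝ) / 2) *
        Real.exp (Real.sqrt (z * (d + z)) - z)) (Ici 0) := fun z hz => by
    simp only [div_sigmaStar hd hz]
  refine mul_expRemainder_lt_one (k := k) (K := fun z =>
    (1 + 2 * sigmaStar d z) ^ ((d : ℝ) / 2) * Real.exp (z / sigmaStar d z)) (fun _ => rfl)
    (fun z hz => ?_) ?_ ?_ hz h
  · have h0 := sigmaStar_nonneg d hz
    exact one_le_mul_of_one_le_of_one_le (Real.one_le_rpow (by linarith) (by positivity))
      (Real.one_le_exp (by positivity))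
  · refine MonotoneOn.congr ?_ hK.symm
    intro a ha b hb hab
    rw [mem_Ici] at ha hb
    have h0 := sigmaStar_nonneg d ha
    have h1 : sigmaStar d a ≤ sigmaStar d b := by
      unfold sigmaStar; gcongr
    have h2 : Real.sqrt (a * (d + a)) - a ≤ Real.sqrt (b * (d + b)) - b := by
      have hs := Real.sq_sqrt (show 0 ≤ a * (d + a) by positivity)
      have hs0 := Real.sqrt_nonneg (a * (d + a))
      set s := Real.sqrt (a * (d + a))
      -- The inequality of arithmetic and geometric means for `a` and `d + a`; it makes `√(z(d+z))`
      -- grow at least as fast as `z`.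
      have hle : 2 * s ≤ 2 * a + d := abs_le_of_sq_le_sq' (by nlinarith) (by positivity) |>.2
      have : s + (b - a) ≤ Real.sqrt (b * (d + b)) := by
        apply Real.le_sqrt_of_sq_le
        nlinarith [mul_le_mul_of_nonneg_left hle (sub_nonneg.2 hab)]
      linarith
    have h3 := Real.rpow_nonneg (show 0 ≤ 1 + 2 * sigmaStar d b by linarith) ((d : ℝ) / 2)
    dsimp only
    gcongr
  · refine ContinuousOn.congr ?_ hK
    refine ContinuousOn.mul (ContinuousOn.rpow_const ?_ fun z _ => Or.inr (by positivity)) ?_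
    · unfold sigmaStar; fun_prop
    · fun_prop

theorem min_lt_one_of_lt_densityConst {k d : ℕ} (hd : 1 ≤ d) {z : ℝ} (hz : 0 ≤ z)
    (h : z < densityConst k d) : min (hFun k z) (gFun k d z) < 1 := by
  rcases lt_max_iff.1 h with h | h
  · exact min_lt_of_left_lt (hFun_lt_one hz h)
  · exact min_lt_of_right_lt (gFun_lt_one hd hz h)

theorem hFun_nonneg (k : ℕ) {z : ℝ} (hz : 0 ≤ z) : 0 ≤ hFun k z :=
  mul_nonneg (Real.exp_nonneg _) (expRemainder_nonneg k hz)

theorem gFun_nonneg (k d : ℕ) {z : ℝ} (hz : 0 ≤ z) : 0 ≤ gFun k d z := by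
  have := sigmaStar_nonneg d hz
  have := expRemainder_nonneg k hz
  unfold gFun; positivity

/-! ### The sampling inequalities with explicit constants -/

variable {d : ℕ} {ι : Type*} {V : ι → Set (EuclideanSpace ℝ (Fin d))}
  {x : ι → EuclideanSpace ℝ (Fin d)} {ρ : ℝ}

theorem CellPartition.exists_sampleBound [Countable ι] (hd : 1 ≤ d) (hV : CellPartition V x ρ)
    (hρ : 0 ≤ ρ) {m : ℝ} (hm : 0 < m) (k : ℕ) :
    ∃ κ, 0 ≤ κ ∧ SampleBound V x m κ ∧
      κ * expRemainder k (m * ρ) ^ 2 ≤ min (hFun k (m * ρ)) (gFun k d (m * ρ)) ^ 2 := by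
  have hz : 0 ≤ m * ρ := by positivity
  have hexp : SampleBound V x m (Real.exp (2 * (m * ρ))) := hV.sampleBound_exp hρ hm
  have hh : Real.exp (2 * (m * ρ)) * expRemainder k (m * ρ) ^ 2 = hFun k (m * ρ) ^ 2 := by
    rw [hFun, mul_pow, ← Real.exp_nat_mul, Nat.cast_ofNat]
  rcases le_or_gt (hFun k (m * ρ)) (gFun k d (m * ρ)) with hle | hlt
  · exact ⟨_, (Real.exp_pos _).le, hexp, by rw [min_eq_left hle, hh]⟩
  -- For `ρ = 0` the ball radius below would degenerate, but then `R_k(0) = 0` and any `κ` works.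
  rcases hρ.eq_or_lt with rfl | hρ'
  · refine ⟨_, (Real.exp_pos _).le, hexp, ?_⟩
    rw [mul_zero, expRemainder_zero, zero_pow two_ne_zero, mul_zero]
    exact sq_nonneg _
  have hz' : 0 < m * ρ := by positivity
  have hσ := sigmaStar_pos hd hz'
  set σ := sigmaStar d (m * ρ) with hσdef
  -- This radius makes `1 + ρ/r = 1 + 2σ` and `2mr = mρ/σ`. The value `σ*` is the critical point of
  -- `(1 + 2σ)^{d/2} e^{z/σ}` in `σ`.
  have hr : 0 < ρ / (2 * σ) := by positivity
  refine ⟨_, by positivity, hV.sampleBound_ball hρ hm hr, ?_⟩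
  rw [min_eq_right hlt.le, gFun, mul_pow, ← hσdef]
  gcongr
  rw [mul_pow, ← Real.rpow_natCast (_ ^ ((d : ℝ) / 2)), ← Real.rpow_mul (by positivity),
    ← Real.exp_nat_mul]
  have e1 : ρ / (ρ / (2 * σ)) = 2 * σ := by field_simp
  have e2 : (d : ℝ) / 2 * (2 : ℕ) = d := by push_cast; ring
  rw [e1, e2, Real.rpow_natCast]
  -- There is slack here: `κ` contains `e^{z/σ}`, whereas `g_{k,d}²` contains `e^{2z/σ}`.
  refine mul_le_mul_of_nonneg_left (Real.exp_le_exp.2 ?_) (by positivity)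
  have : m * (ρ / (2 * σ)) = (m * ρ / σ) / 2 := by field_simp
  rw [this]
  have : 0 ≤ m * ρ / σ := by positivity
  push_cast
  linarith

theorem CellPartition.tsum_sampleEnergy_le_exp [Countable ι] (hV : CellPartition V x ρ)
    (hρ : 0 ≤ ρ) {m : ℝ} (hm : 0 < m) {u : EuclideanSpace ℝ (Fin d) → ℂ} (hu : BandSpectrum m u)
    (k : ℕ) :
    ∑' n, sampleEnergy V x k u n ≤
      ENNReal.ofReal (Real.exp (2 * (m * ρ) + (m * ρ) ^ 2)) * ∫⁻ ξ, ‖u ξ‖ₑ ^ 2 := by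
  rw [Real.exp_add, ENNReal.ofReal_mul (Real.exp_nonneg _)]
  exact hV.tsum_sampleEnergy_le hρ (hV.sampleBound_exp hρ hm) hu k

theorem BandSpectrum.lintegral_enorm_sq_ne_top {R : ℝ} {u : EuclideanSpace ℝ (Fin d) → ℂ}
    (hu : BandSpectrum R u) : ∫⁻ ξ, ‖u ξ‖ₑ ^ 2 ≠ ⊤ := by
  have h := lintegral_rpow_enorm_lt_top_of_eLpNorm_lt_top (by norm_num) (by norm_num) hu.memLp.2
  simpa using h.ne

theorem CellPartition.le_tsum_sampleEnergy [Countable ι] (hd : 1 ≤ d) (hV : CellPartition V x ρ)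
    (hρ : 0 ≤ ρ) {m : ℝ} (hm : 0 < m) {u : EuclideanSpace ℝ (Fin d) → ℂ} (hu : BandSpectrum m u)
    (k : ℕ) (hlt : min (hFun k (m * ρ)) (gFun k d (m * ρ)) < 1) :
    Real.exp (-(d : ℝ)) * (1 - min (hFun k (m * ρ)) (gFun k d (m * ρ))) ^ 2 *
      (∫⁻ ξ, ‖u ξ‖ₑ ^ 2).toReal ≤ (∑' n, sampleEnergy V x k u n).toReal := by
  have hz : 0 ≤ m * ρ := by positivity
  have hU := hu.lintegral_enorm_sq_ne_top
  have hS : ∑' n, sampleEnergy V x k u n ≠ ⊤ :=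
    ne_top_of_le_ne_top (ENNReal.mul_ne_top ENNReal.ofReal_ne_top hU)
      (hV.tsum_sampleEnergy_le_exp hρ hm hu k)
  obtain ⟨κ, hκ0, hκ, hκq⟩ := hV.exists_sampleBound hd hρ hm k
  set p := min (hFun k (m * ρ)) (gFun k d (m * ρ)) with hp
  have hp0 : 0 ≤ p := le_min (hFun_nonneg k hz) (gFun_nonneg k d hz)
  set U := (∫⁻ ξ, ‖u ξ‖ₑ ^ 2).toReal with hUdef
  set S := (∑' n, sampleEnergy V x k u n).toReal with hSdef
  have hU0 : 0 ≤ U := ENNReal.toReal_nonneg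
  have hS0 : 0 ≤ S := ENNReal.toReal_nonneg
  have key : ∀ q ∈ Ioo p 1, (1 - q) ^ 2 * U ≤ Real.exp d * S := by
    intro q hq
    have hq0 : 0 < q := lt_of_le_of_lt hp0 hq.1
    have h1q : 0 < 1 - q := by linarith [hq.2]
    have h := hV.lintegral_enorm_sq_le hρ hm hκ hu k hq0 hq.2
    rw [expTail_succ k hz, ← ENNReal.ofReal_toReal hU, ← ENNReal.ofReal_toReal hS, ← hUdef,
      ← hSdef, ← ENNReal.ofReal_pow (expRemainder_nonneg k hz), ← ENNReal.ofReal_mul hκ0,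
      ← ENNReal.ofReal_mul (by positivity), ← ENNReal.ofReal_mul (by positivity),
      ← ENNReal.ofReal_mul (by positivity), ← ENNReal.ofReal_mul (by positivity),
      ← ENNReal.ofReal_add (by positivity) (by positivity),
      ENNReal.ofReal_le_ofReal_iff (by positivity)] at h
    have h1 : 1 / q * (κ * expRemainder k (m * ρ) ^ 2 * U) ≤ q * U := by
      rw [one_div_mul_eq_div, div_le_iff₀ hq0]
      calc κ * expRemainder k (m * ρ) ^ 2 * U ≤ q ^ 2 * U := by
            gcongr
            exact hκq.trans (by gcongr; exact hq.1.le)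
        _ = q * U * q := by ring
    have h2 : (1 - q) * U ≤ (Real.exp d * S) / (1 - q) := by
      rw [← one_div_mul_eq_div]
      linarith
    rw [le_div_iff₀ h1q] at h2
    linarith
  -- The choice `q = p` is excluded when `p = 0`, hence the limit from above.
  have hlim : (1 - p) ^ 2 * U ≤ Real.exp d * S := by
    have hcont : Filter.Tendsto (fun q : ℝ => (1 - q) ^ 2 * U) (nhdsWithin p (Ioi p))
        (nhds ((1 - p) ^ 2 * U)) :=
      (Continuous.tendsto (by fun_prop) p).mono_left nhdsWithin_le_nhds
    refine le_of_tendsto hcont ?_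
    filter_upwards [Ioo_mem_nhdsGT hlt] with q hq using key q hq
  calc Real.exp (-(d : ℝ)) * (1 - p) ^ 2 * U = Real.exp (-(d : ℝ)) * ((1 - p) ^ 2 * U) := by ring
    _ ≤ Real.exp (-(d : ℝ)) * (Real.exp d * S) := by gcongr
    _ = S := by rw [← mul_assoc, ← Real.exp_add]; simp

end DerivativeSampling

namespace DerivativeSampling

variable {d : ℕ} {ι : Type*}

/-! ### Norms and Voronoi cells -/

theorem seminorm_continuous (N : Seminorm ℝ (EuclideanSpace ℝ (Fin d))) : Continuous N := by
  set C := ∑ j, N (EuclideanSpace.single j 1) with hC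
  have hC0 : 0 ≤ C := Finset.sum_nonneg fun j _ => apply_nonneg N _
  have hbd : ∀ y, N y ≤ C * ‖y‖ := by
    intro y
    have hy : y = ∑ j, y j • EuclideanSpace.single j (1 : ℝ) := by
      ext i
      simp [Finset.sum_apply, Pi.single_apply]
    calc N y = N (∑ j, y j • EuclideanSpace.single j (1 : ℝ)) := by rw [← hy]
      _ ≤ ∑ j, N (y j • EuclideanSpace.single j (1 : ℝ)) :=
          Finset.le_sum_of_subadditive N (map_zero N).le (map_add_le_add N) _ _
      _ ≤ ∑ j, N (EuclideanSpace.single j 1) * ‖y‖ := by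
          refine Finset.sum_le_sum fun j _ => ?_
          rw [map_smul_eq_mul, mul_comm]
          gcongr
          exact PiLp.norm_apply_le y j
      _ = C * ‖y‖ := by rw [hC, Finset.sum_mul]
  refine Seminorm.continuous_of_le (q := C.toNNReal • normSeminorm ℝ _) ?_ fun y => ?_
  · have : ⇑(C.toNNReal • normSeminorm ℝ (EuclideanSpace ℝ (Fin d))) = fun y => C * ‖y‖ := by
      ext y
      simp [NNReal.smul_def, hC0]
    rw [this]
    fun_prop
  · refine (hbd y).trans (le_of_eq ?_)
    simp [NNReal.smul_def, hC0]

theorem normConst_set_nonempty (N : Seminorm ℝ (EuclideanSpace ℝ (Fin d)))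
    (hN : ∀ y, N y = 0 → y = 0) : {b : ℝ | 0 < b ∧ ∀ x, ‖x‖ ≤ b * N x}.Nonempty := by
  rcases (Metric.sphere (0 : EuclideanSpace ℝ (Fin d)) 1).eq_empty_or_nonempty with he | hne
  · refine ⟨1, one_pos, fun y => ?_⟩
    by_cases hy : y = 0
    · simp [hy]
    · exfalso
      have : ‖y‖⁻¹ • y ∈ Metric.sphere (0 : EuclideanSpace ℝ (Fin d)) 1 := by
        rw [mem_sphere_zero_iff_norm, norm_smul, norm_inv, norm_norm,
          inv_mul_cancel₀ (norm_ne_zero_iff.2 hy)]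
      rw [he] at this
      exact this
  · obtain ⟨y₀, hy₀, hmin⟩ := (isCompact_sphere (0 : EuclideanSpace ℝ (Fin d)) 1).exists_isMinOn hne
      (seminorm_continuous N).continuousOn
    have hc : 0 < N y₀ := lt_of_le_of_ne (apply_nonneg N _) fun h => by
      rw [hN _ h.symm, mem_sphere_zero_iff_norm, norm_zero] at hy₀
      exact zero_ne_one hy₀
    refine ⟨(N y₀)⁻¹, inv_pos.2 hc, fun y => ?_⟩
    by_cases hy : y = 0
    · simp [hy]
    · have hy' := norm_pos_iff.2 hy
      have h1 : N y₀ ≤ N (‖y‖⁻¹ • y) := hmin (by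
        rw [mem_sphere_zero_iff_norm, norm_smul, norm_inv, norm_norm, inv_mul_cancel₀ hy'.ne'])
      rw [map_smul_eq_mul, norm_inv, norm_norm, inv_mul_eq_div, le_div_iff₀ hy'] at h1
      rw [inv_mul_eq_div, le_div_iff₀ hc, mul_comm]
      exact h1

theorem norm_le_normConst_mul (N : Seminorm ℝ (EuclideanSpace ℝ (Fin d)))
    (hN : ∀ y, N y = 0 → y = 0) (y : EuclideanSpace ℝ (Fin d)) : ‖y‖ ≤ normConst N * N y := by
  rcases (apply_nonneg N y).eq_or_lt with h | h
  · simp [hN y h.symm]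
  · rw [← div_le_iff₀ h]
    refine le_csInf (normConst_set_nonempty N hN) fun b hb => ?_
    rw [div_le_iff₀ h]
    exact hb.2 y

theorem normConst_nonneg (N : Seminorm ℝ (EuclideanSpace ℝ (Fin d))) : 0 ≤ normConst N :=
  Real.sInf_nonneg fun _ hb => hb.1.le

theorem normConst_pos (hd : 1 ≤ d) (N : Seminorm ℝ (EuclideanSpace ℝ (Fin d)))
    (hN : ∀ y, N y = 0 → y = 0) : 0 < normConst N := by
  refine lt_of_le_of_ne (normConst_nonneg N) fun h => ?_
  have := norm_le_normConst_mul N hN (EuclideanSpace.single ⟨0, hd⟩ 1)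
  rw [← h] at this
  norm_num at this

/-- A point of `V_n` has `x_n` as a nearest node, so its `N`-distance to `x_n` is the infimum over
all nodes and hence at most `δ`; the norm comparison turns this into `bδ`. -/
theorem cellPartition_voronoiCell (N : Seminorm ℝ (EuclideanSpace ℝ (Fin d)))
    (hN : ∀ y, N y = 0 → y = 0) (x : ι → EuclideanSpace ℝ (Fin d))
    (hV : ∀ᵐ y ∂(volume : Measure (EuclideanSpace ℝ (Fin d))), ∃! n, y ∈ voronoiCell N x n)
    (hδ : density N x ≠ ⊤) :
    CellPartition (voronoiCell N x) x (normConst N * (density N x).toReal) where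
  measurableSet n := by
    have hc := seminorm_continuous N
    simp only [voronoiCell, ofPred_forall]
    refine IsClosed.measurableSet (isClosed_iInter fun m => isClosed_iInter fun _ => ?_)
    exact isClosed_le (by fun_prop) (by fun_prop)
  existsUnique := hV
  norm_sub_node_le n y hy := by
    refine (norm_le_normConst_mul N hN _).trans
      (mul_le_mul_of_nonneg_left ?_ (normConst_nonneg N))
    rw [← ENNReal.ofReal_le_iff_le_toReal hδ]
    refine le_trans (le_iInf fun m => ENNReal.ofReal_le_ofReal ?_)
      (le_iSup (fun y => ⨅ n, ENNReal.ofReal (N (y - x n))) y)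
    by_cases hm : m = n
    · rw [hm]
    · exact hy m hm

theorem CellPartition.ofReal_weight {N : Seminorm ℝ (EuclideanSpace ℝ (Fin d))}
    {x : ι → EuclideanSpace ℝ (Fin d)} {ρ : ℝ} (hV : CellPartition (voronoiCell N x) x ρ)
    (n : ι) (α : Fin d → ℕ) :
    ENNReal.ofReal (weight N x n α) = cellMoment (voronoiCell N x) x n α := by
  rw [weight, cellMoment, ENNReal.ofReal_mul (by positivity), ofReal_integral_eq_lintegral_ofReal]
  · have hsub : voronoiCell N x n ⊆ Metric.closedBall (x n) ρ := fun y hy => by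
      rw [mem_closedBall_iff_norm]; exact hV.norm_sub_node_le n y hy
    refine IntegrableOn.mono_set ?_ hsub
    exact ContinuousOn.integrableOn_compact (isCompact_closedBall _ _)
      (Continuous.continuousOn (by fun_prop))
  · exact Filter.Eventually.of_forall fun y =>
      Finset.prod_nonneg fun j _ => (even_two_mul _).pow_nonneg _

theorem weight_nonneg (N : Seminorm ℝ (EuclideanSpace ℝ (Fin d)))
    (x : ι → EuclideanSpace ℝ (Fin d)) (n : ι) (α : Fin d → ℕ) : 0 ≤ weight N x n α :=
  mul_nonneg (by positivity)
    (integral_nonneg fun y => Finset.prod_nonneg fun j _ => (even_two_mul _).pow_nonneg _)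

/-! ### Bandlimited functions through their spectra -/

theorem mem_bandlimited_iff {Ω : Set (EuclideanSpace ℝ (Fin d))}
    {f : Lp ℂ 2 (volume : Measure (EuclideanSpace ℝ (Fin d)))} :
    f ∈ bandlimited Ω ↔ ∀ᵐ ξ, (2 * Real.pi) • ξ ∉ Ω →
      (𝓕 f : Lp ℂ 2 (volume : Measure (EuclideanSpace ℝ (Fin d)))) ξ = 0 := by
  have h0 : (2 * Real.pi) ≠ 0 := by positivity
  constructor
  · intro h
    have hq : Measure.QuasiMeasurePreserving
        (fun ξ : EuclideanSpace ℝ (Fin d) => (2 * Real.pi) • ξ) volume volume := by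
      refine ⟨measurable_const_smul _, ?_⟩
      rw [Measure.map_addHaar_smul _ h0]
      exact Measure.smul_absolutelyContinuous
    have h' : ∀ᵐ ξ, ξ ∉ Ω → angularFourier f ξ = 0 := h
    filter_upwards [hq.ae h'] with ξ hξ hΩ
    have := hξ hΩ
    rwa [angularFourier, inv_smul_smul₀ h0] at this
  · intro h
    change ∀ᵐ ξ, ξ ∉ Ω → angularFourier f ξ = 0
    filter_upwards [(quasiMeasurePreserving_scale d).ae h] with ξ hξ hΩ
    exact hξ (by rwa [smul_inv_smul₀ h0])

theorem norm_le_domainRadius {Ω : Set (EuclideanSpace ℝ (Fin d))} (hΩ : IsCompact Ω)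
    {ξ : EuclideanSpace ℝ (Fin d)} (hξ : ξ ∈ Ω) : ‖ξ‖ ≤ domainRadius Ω :=
  le_csSup (hΩ.image continuous_norm).bddAbove (mem_image_of_mem _ hξ)

theorem domainRadius_nonneg (Ω : Set (EuclideanSpace ℝ (Fin d))) : 0 ≤ domainRadius Ω :=
  Real.sSup_nonneg (by rintro _ ⟨ξ, -, rfl⟩; exact norm_nonneg ξ)

theorem bandSpectrum_fourier {Ω : Set (EuclideanSpace ℝ (Fin d))} (hΩ : IsCompact Ω)
    {f : Lp ℂ 2 (volume : Measure (EuclideanSpace ℝ (Fin d)))} (hf : f ∈ bandlimited Ω) :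
    BandSpectrum (domainRadius Ω)
      (𝓕 f : Lp ℂ 2 (volume : Measure (EuclideanSpace ℝ (Fin d)))) := by
  refine ⟨Lp.memLp _, ?_⟩
  filter_upwards [mem_bandlimited_iff.1 hf] with ξ hξ h
  refine hξ fun hmem => h.not_ge ?_
  have := norm_le_domainRadius hΩ hmem
  rwa [norm_smul, Real.norm_eq_abs, abs_of_pos (by positivity)] at this

theorem ae_eq_fourierInv_fourier {Ω : Set (EuclideanSpace ℝ (Fin d))} (hΩ : IsCompact Ω)
    {f : Lp ℂ 2 (volume : Measure (EuclideanSpace ℝ (Fin d)))} (hf : f ∈ bandlimited Ω) :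
    f =ᵐ[volume] 𝓕⁻ ((𝓕 f : Lp ℂ 2 (volume : Measure (EuclideanSpace ℝ (Fin d)))) :
      EuclideanSpace ℝ (Fin d) → ℂ) := by
  have h := Lp_fourierInv_ae_eq (𝓕 f) (bandSpectrum_fourier hΩ hf).integrable
  rwa [FourierTransform.fourierInv_fourier_eq] at h

theorem norm_sq_eq_lintegral_fourier
    (f : Lp ℂ 2 (volume : Measure (EuclideanSpace ℝ (Fin d)))) :
    ‖f‖ ^ 2 = (∫⁻ ξ, ‖(𝓕 f : Lp ℂ 2 (volume : Measure (EuclideanSpace ℝ (Fin d)))) ξ‖ₑ ^ 2).toReal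
    := by
  rw [← Lp_enorm_sq_eq_lintegral, ENNReal.toReal_pow, toReal_enorm, Lp.norm_fourier_eq]

/-- The value at `y` of the derivative `D^α` of the smooth representative of `f`. -/
noncomputable def sampleDeriv (f : Lp ℂ 2 (volume : Measure (EuclideanSpace ℝ (Fin d))))
    (α : Fin d → ℕ) (y : EuclideanSpace ℝ (Fin d)) : ℂ :=
  𝓕⁻ (fun ξ => derivSymbol α ξ *
    (𝓕 f : Lp ℂ 2 (volume : Measure (EuclideanSpace ℝ (Fin d)))) ξ) y

/-- Two continuous functions that agree almost everywhere are equal, so the existential over smooth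
representatives can only be met by `𝓕⁻ (𝓕 f)`. -/
theorem stableSampling_iff {Ω : Set (EuclideanSpace ℝ (Fin d))} (hΩ : IsCompact Ω)
    {x : ι → EuclideanSpace ℝ (Fin d)} {μ : ι → (Fin d → ℕ) → ℝ} {k : ℕ} {A B : ℝ} :
    StableSampling Ω x μ k A B ↔ ∀ f ∈ bandlimited Ω,
      Summable (fun n => ∑ α ∈ multiIndices d k, μ n α * ‖sampleDeriv f α (x n)‖ ^ 2) ∧
      A * ‖f‖ ^ 2 ≤ ∑' n, ∑ α ∈ multiIndices d k, μ n α * ‖sampleDeriv f α (x n)‖ ^ 2 ∧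
      ∑' n, ∑ α ∈ multiIndices d k, μ n α * ‖sampleDeriv f α (x n)‖ ^ 2 ≤ B * ‖f‖ ^ 2 := by
  refine forall₂_congr fun f hf => ?_
  have hb := bandSpectrum_fourier hΩ hf
  have hae := ae_eq_fourierInv_fourier hΩ hf
  set F₀ : EuclideanSpace ℝ (Fin d) → ℂ :=
    𝓕⁻ ((𝓕 f : Lp ℂ 2 (volume : Measure (EuclideanSpace ℝ (Fin d)))) :
      EuclideanSpace ℝ (Fin d) → ℂ) with hF₀
  have hder : ∀ α y, multiDeriv α F₀ y = sampleDeriv f α y := fun α y => by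
    rw [hF₀, hb.multiDeriv]; rfl
  simp only [← hder]
  constructor
  · rintro ⟨F, hF, hfF, h⟩
    have : F = F₀ := (Continuous.ae_eq_iff_eq volume hF.continuous hb.contDiff.continuous).1
      (hfF.symm.trans hae)
    rwa [this] at h
  · exact fun h => ⟨F₀, hb.contDiff, hae, h⟩

end DerivativeSampling

namespace DerivativeSampling

variable {d : ℕ} {ι : Type*}

/-! ### The kernel frame -/

/-- The set `Ω / 2π` of ordinary frequencies. -/
def scaledDomain (Ω : Set (EuclideanSpace ℝ (Fin d))) : Set (EuclideanSpace ℝ (Fin d)) :=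
  (fun ξ => (2 * Real.pi) • ξ) ⁻¹' Ω

/-- The substitution from angular to ordinary frequency; its Jacobian is the prefactor `(2π)^{-d}`.
-/
theorem kernelPhi_eq_fourierInv {Ω : Set (EuclideanSpace ℝ (Fin d))} (hΩ : IsCompact Ω) :
    kernelPhi Ω = 𝓕⁻ ((scaledDomain Ω).indicator 1 : EuclideanSpace ℝ (Fin d) → ℂ) := by
  have hp : 0 < 2 * Real.pi := by positivity
  have hS : MeasurableSet (scaledDomain Ω) := measurable_const_smul _ hΩ.measurableSet
  ext y
  set G : EuclideanSpace ℝ (Fin d) → ℂ :=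
    Ω.indicator fun ξ => Complex.exp (Complex.I * ((∑ j, ξ j * y j : ℝ) : ℂ)) with hG
  have h := Measure.integral_comp_smul (volume : Measure (EuclideanSpace ℝ (Fin d))) G (2 * Real.pi)
  rw [finrank_euclideanSpace_fin, abs_of_pos (by positivity)] at h
  rw [kernelPhi, ← integral_indicator hΩ.measurableSet, Real.fourierInv_eq', ← hG]
  have e1 : ∫ v, Complex.exp (↑(2 * Real.pi * inner ℝ v y) * Complex.I) •
      (scaledDomain Ω).indicator (1 : EuclideanSpace ℝ (Fin d) → ℂ) v =
      ∫ v, G ((2 * Real.pi) • v) := by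
    congr 1
    ext v
    by_cases hv : v ∈ scaledDomain Ω
    · have hv' : (2 * Real.pi) • v ∈ Ω := hv
      rw [indicator_of_mem hv, hG, indicator_of_mem hv', Pi.one_apply, smul_eq_mul, mul_one,
        mul_comm Complex.I]
      congr 3
      simp only [PiLp.inner_apply, RCLike.inner_apply, conj_trivial, PiLp.smul_apply, smul_eq_mul,
        Finset.mul_sum]
      exact Finset.sum_congr rfl fun j _ => by ring
    · have hv' : (2 * Real.pi) • v ∉ Ω := hv
      rw [indicator_of_notMem hv, hG, indicator_of_notMem hv', smul_zero]
  rw [e1, h, Complex.real_smul]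
  push_cast
  rw [one_div]

/-- The spectrum of `D^α Φ_Ω(· - a)`. -/
noncomputable def atomSpectrum (Ω : Set (EuclideanSpace ℝ (Fin d)))
    (a : EuclideanSpace ℝ (Fin d)) (α : Fin d → ℕ) (ξ : EuclideanSpace ℝ (Fin d)) : ℂ :=
  derivSymbol α ξ * (Complex.exp (2 * Real.pi * Complex.I * (inner ℝ ξ (-a) : ℝ)) *
    (scaledDomain Ω).indicator 1 ξ)

theorem bandSpectrum_indicator {Ω : Set (EuclideanSpace ℝ (Fin d))} (hΩ : IsCompact Ω) :
    BandSpectrum (domainRadius Ω) ((scaledDomain Ω).indicator 1 :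
      EuclideanSpace ℝ (Fin d) → ℂ) := by
  have hp : (2 * Real.pi) ≠ 0 := by positivity
  have hS : IsCompact (scaledDomain Ω) :=
    (Homeomorph.smulOfNeZero (2 * Real.pi) hp).isCompact_preimage.2 hΩ
  refine ⟨memLp_indicator_const 2 hS.measurableSet 1 (Or.inr hS.measure_lt_top.ne),
    Filter.Eventually.of_forall fun ξ h => indicator_of_notMem (fun hmem => h.not_ge ?_) _⟩
  have := norm_le_domainRadius hΩ (show (2 * Real.pi) • ξ ∈ Ω from hmem)
  rwa [norm_smul, Real.norm_eq_abs, abs_of_pos (by positivity)] at this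

theorem bandSpectrum_translate {Ω : Set (EuclideanSpace ℝ (Fin d))} (hΩ : IsCompact Ω)
    (a : EuclideanSpace ℝ (Fin d)) : BandSpectrum (domainRadius Ω)
      (fun ξ => Complex.exp (2 * Real.pi * Complex.I * (inner ℝ ξ (-a) : ℝ)) *
        (scaledDomain Ω).indicator 1 ξ) :=
  (bandSpectrum_indicator hΩ).mul_continuous (by fun_prop)

theorem bandSpectrum_atomSpectrum {Ω : Set (EuclideanSpace ℝ (Fin d))} (hΩ : IsCompact Ω)
    (a : EuclideanSpace ℝ (Fin d)) (α : Fin d → ℕ) :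
    BandSpectrum (domainRadius Ω) (atomSpectrum Ω a α) :=
  (bandSpectrum_translate hΩ a).derivSymbol_mul α

theorem multiDeriv_kernelPhi {Ω : Set (EuclideanSpace ℝ (Fin d))} (hΩ : IsCompact Ω)
    (a : EuclideanSpace ℝ (Fin d)) (α : Fin d → ℕ) :
    multiDeriv α (fun z => kernelPhi Ω (z - a)) = 𝓕⁻ (atomSpectrum Ω a α) := by
  have : (fun z => kernelPhi Ω (z - a)) =
      𝓕⁻ (fun ξ => Complex.exp (2 * Real.pi * Complex.I * (inner ℝ ξ (-a) : ℝ)) *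
        (scaledDomain Ω).indicator 1 ξ) := by
    ext z
    rw [kernelPhi_eq_fourierInv hΩ, sub_eq_add_neg, fourierInv_add_eq]
  rw [this, (bandSpectrum_translate hΩ a).multiDeriv]
  rfl

theorem conj_derivSymbol (α : Fin d → ℕ) (ξ : EuclideanSpace ℝ (Fin d)) :
    (starRingEnd ℂ) (derivSymbol α ξ) = (-1) ^ (∑ j, α j) * derivSymbol α ξ := by
  rw [derivSymbol, map_prod, ← Finset.prod_pow_eq_pow_sum, ← Finset.prod_mul_distrib]
  refine Finset.prod_congr rfl fun j _ => ?_
  rw [← mul_pow, map_pow]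
  congr 1
  simp only [map_mul, Complex.conj_ofReal, Complex.conj_I, map_ofNat]
  ring

/-- The atom has spectrum `(2πiξ)^α e^{-2πi⟨ξ,a⟩}` on `Ω/2π`. Pairing it with `𝓕 f` is the inversion
integral for `D^α f(a)`, up to the sign `(-1)^{|α|}` from conjugating the symbol, which the modulus
removes. -/
theorem exists_kernelAtom {Ω : Set (EuclideanSpace ℝ (Fin d))} (hΩ : IsCompact Ω)
    (a : EuclideanSpace ℝ (Fin d)) (α : Fin d → ℕ) {c : ℝ} (hc : 0 ≤ c) :
    ∃ φ : bandlimited Ω,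
      ((φ : Lp ℂ 2 (volume : Measure (EuclideanSpace ℝ (Fin d)))) =ᵐ[volume]
        fun y => (Real.sqrt c : ℂ) * multiDeriv α (fun z => kernelPhi Ω (z - a)) y) ∧
      ∀ f : bandlimited Ω, ‖inner ℂ φ f‖ ^ 2 = c * ‖sampleDeriv f.1 α a‖ ^ 2 := by
  have hb := bandSpectrum_atomSpectrum hΩ a α
  set v : Lp ℂ 2 (volume : Measure (EuclideanSpace ℝ (Fin d))) := hb.memLp.toLp _ with hv
  have hvae : v =ᵐ[volume] atomSpectrum Ω a α := hb.memLp.coeFn_toLp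
  set w : Lp ℂ 2 (volume : Measure (EuclideanSpace ℝ (Fin d))) := 𝓕⁻ v with hw
  have hFw : (𝓕 w : Lp ℂ 2 (volume : Measure (EuclideanSpace ℝ (Fin d)))) = v := by
    rw [hw, FourierTransform.fourier_fourierInv_eq]
  have hwmem : w ∈ bandlimited Ω := by
    rw [mem_bandlimited_iff, hFw]
    filter_upwards [hvae] with ξ hξ hnot
    rw [hξ, atomSpectrum, indicator_of_notMem (show ξ ∉ scaledDomain Ω from hnot), mul_zero,
      mul_zero]
  refine ⟨(Real.sqrt c : ℂ) • ⟨w, hwmem⟩, ?_, ?_⟩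
  · have h1 := Lp_fourierInv_ae_eq v (hb.integrable.congr hvae.symm)
    have h2 : 𝓕⁻ (v : EuclideanSpace ℝ (Fin d) → ℂ) = 𝓕⁻ (atomSpectrum Ω a α) := by
      ext y; exact Real.fourierInv_congr_ae hvae y
    rw [h2] at h1
    rw [Submodule.coe_smul]
    filter_upwards [h1, Lp.coeFn_smul (Real.sqrt c : ℂ) w] with y hy hy2
    rw [hy2, Pi.smul_apply, smul_eq_mul, multiDeriv_kernelPhi hΩ, ← hy]
  · intro f
    have hin : inner ℂ w f.1 = (-1) ^ (∑ j, α j) * sampleDeriv f.1 α a := by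
      rw [← Lp.inner_fourier_eq, hFw, L2.inner_def, sampleDeriv, Real.fourierInv_eq',
        ← integral_const_mul]
      refine integral_congr_ae ?_
      filter_upwards [hvae, mem_bandlimited_iff.1 f.2] with ξ hξ hf
      rw [hξ]
      by_cases hmem : ξ ∈ scaledDomain Ω
      · rw [atomSpectrum, indicator_of_mem hmem, RCLike.inner_apply, map_mul, conj_derivSymbol,
          Pi.one_apply, mul_one, ← Complex.exp_conj]
        have : (starRingEnd ℂ) (2 * Real.pi * Complex.I * (inner ℝ ξ (-a) : ℝ)) =
            ↑(2 * Real.pi * inner ℝ ξ a) * Complex.I := by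
          simp only [map_mul, Complex.conj_ofReal, Complex.conj_I, inner_neg_right, map_ofNat]
          push_cast
          ring
        rw [this, smul_eq_mul]
        ring
      · rw [hf hmem]
        simp
    have hsmul : inner ℂ ((Real.sqrt c : ℂ) • (⟨w, hwmem⟩ : bandlimited Ω)) f =
        inner ℂ ((Real.sqrt c : ℂ) • w) f.1 := rfl
    rw [hsmul, inner_smul_left, norm_mul, hin, norm_mul, norm_pow, norm_neg, norm_one,
      one_pow, one_mul, mul_pow, Complex.conj_ofReal, Complex.norm_real, Real.norm_eq_abs, sq_abs,
      Real.sq_sqrt hc]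

theorem summable_prod_multiIndices_iff {k : ℕ} {g : ι → (Fin d → ℕ) → ℝ} (hg : ∀ n α, 0 ≤ g n α) :
    (Summable fun p : ι × {α // α ∈ multiIndices d k} => g p.1 p.2) ↔
      Summable fun n => ∑ α ∈ multiIndices d k, g n α := by
  refine (summable_prod_of_nonneg (f := fun p : ι × {α // α ∈ multiIndices d k} => g p.1 p.2)
    fun p => hg p.1 p.2).trans ?_
  simp only [tsum_fintype, fun n => Finset.sum_coe_sort (multiIndices d k) (g n)]
  exact and_iff_right fun n => Summable.of_finite

theorem kernelFrame_iff_stableSampling {Ω : Set (EuclideanSpace ℝ (Fin d))} (hΩ : IsCompact Ω)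
    {x : ι → EuclideanSpace ℝ (Fin d)} {μ : ι → (Fin d → ℕ) → ℝ} (hμ : ∀ n α, 0 ≤ μ n α)
    {k : ℕ} {A B : ℝ} (hA : 0 < A) (hB : 0 < B) :
    StableSampling Ω x μ k A B ↔ KernelFrame Ω x μ k A B := by
  choose Φ hΦae hΦin using fun p : ι × {α // α ∈ multiIndices d k} =>
    exists_kernelAtom hΩ (x p.1) p.2.1 (hμ p.1 p.2.1)
  have hframe : StableSampling Ω x μ k A B ↔ IsFrameWithBounds Φ A B := by
    rw [stableSampling_iff hΩ, IsFrameWithBounds, Subtype.forall']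
    simp only [hA, hB, true_and]
    refine forall_congr' fun f => ?_
    have hnn : ∀ n α, 0 ≤ μ n α * ‖sampleDeriv f.1 α (x n)‖ ^ 2 := fun n α =>
      mul_nonneg (hμ n α) (sq_nonneg _)
    have hsumm := summable_prod_multiIndices_iff (k := k) hnn
    simp only [hΦin]
    rw [hsumm]
    refine and_congr_right fun h => ?_
    rw [(hsumm.2 h).tsum_prod]
    simp only [tsum_fintype, Submodule.coe_norm, fun n => Finset.sum_coe_sort (multiIndices d k)
      fun α => μ n α * ‖sampleDeriv f.1 α (x n)‖ ^ 2]
  rw [hframe]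
  constructor
  · exact fun h => ⟨Φ, hΦae, h⟩
  · rintro ⟨φ, hφ, h⟩
    -- The prescribed almost everywhere formula determines each frame element.
    have : φ = Φ := by
      ext p : 2
      exact Lp.ext ((hφ p).trans (hΦae p).symm)
    rwa [this] at h

end DerivativeSampling

/-! ### The main theorem -/

open DerivativeSampling in
theorem theorem3p1 {d : ℕ} (hd : 1 ≤ d) (k : ℕ)
    (Ω : Set (EuclideanSpace ℝ (Fin d))) (hΩ : IsCompact Ω)
    (N : Seminorm ℝ (EuclideanSpace ℝ (Fin d))) (hN : ∀ y, N y = 0 → y = 0)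
    {ι : Type*} [Countable ι] (x : ι → EuclideanSpace ℝ (Fin d))
    (hV : ∀ᵐ y ∂(volume : Measure (EuclideanSpace ℝ (Fin d))), ∃! n, y ∈ voronoiCell N x n)
    (hδ : density N x <
      ENNReal.ofReal (densityConst k d) / ENNReal.ofReal (domainRadius Ω * normConst N)) :
    (∃ A B : ℝ, 0 < A ∧ 0 < B ∧
      Real.exp (-(d : ℝ)) *
        (1 - min (hFun k (domainRadius Ω * normConst N * (density N x).toReal))
          (gFun k d (domainRadius Ω * normConst N * (density N x).toReal))) ^ 2 ≤ A ∧
      B ≤ Real.exp (2 * (domainRadius Ω * normConst N * (density N x).toReal) +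
        (domainRadius Ω * normConst N * (density N x).toReal) ^ 2) ∧
      StableSampling Ω x (weight N x) k A B ∧
      KernelFrame Ω x (weight N x) k A B) ∧
    (∀ A B : ℝ, 0 < A → 0 < B →
      (StableSampling Ω x (weight N x) k A B ↔ KernelFrame Ω x (weight N x) k A B)) := by
  have hiff : ∀ A B : ℝ, 0 < A → 0 < B →
      (StableSampling Ω x (weight N x) k A B ↔ KernelFrame Ω x (weight N x) k A B) :=
    fun A B hA hB => kernelFrame_iff_stableSampling hΩ (weight_nonneg N x) hA hB
  refine ⟨?_, hiff⟩
  have hδt : density N x ≠ ⊤ := hδ.ne_top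
  have hb : 0 < normConst N := normConst_pos hd N hN
  have hm : 0 ≤ domainRadius Ω := domainRadius_nonneg Ω
  have hP := cellPartition_voronoiCell N hN x hV hδt
  set δ := (density N x).toReal with hδdef
  have hδ0 : 0 ≤ δ := ENNReal.toReal_nonneg
  set ρ := normConst N * δ with hρ
  have hρ0 : 0 ≤ ρ := by positivity
  rw [mul_assoc, ← hρ]
  have hz : 0 ≤ domainRadius Ω * ρ := by positivity
  set q := min (hFun k (domainRadius Ω * ρ)) (gFun k d (domainRadius Ω * ρ)) with hq
  have hq1 : q < 1 := by
    -- For `m_Ω = 0` the bound holds because `h_k(0) = 0`; otherwise the density hypothesis reads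
    -- `m_Ω b δ < C(k,d)`.
    rcases hm.eq_or_lt with h0 | hpos
    · rw [hq, ← h0, zero_mul]
      refine min_lt_of_left_lt ?_
      rw [hFun, expRemainder_zero, mul_zero]
      exact one_pos
    · refine min_lt_one_of_lt_densityConst hd hz ?_
      have hmb : 0 < domainRadius Ω * normConst N := by positivity
      rw [ENNReal.lt_div_iff_mul_lt (Or.inl (by simpa using hmb)) (Or.inl ENNReal.ofReal_ne_top),
        ← ENNReal.ofReal_toReal hδt, ← ENNReal.ofReal_mul ENNReal.toReal_nonneg,
        ENNReal.ofReal_lt_ofReal_iff_of_nonneg (by positivity), ← hδdef] at hδ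
      calc domainRadius Ω * ρ = δ * (domainRadius Ω * normConst N) := by rw [hρ]; ring
        _ < _ := hδ
  have hA : 0 < Real.exp (-(d : ℝ)) * (1 - q) ^ 2 := by
    have : 0 < 1 - q := by linarith
    positivity
  have hB := Real.exp_pos (2 * (domainRadius Ω * ρ) + (domainRadius Ω * ρ) ^ 2)
  have hstable : StableSampling Ω x (weight N x) k (Real.exp (-(d : ℝ)) * (1 - q) ^ 2)
      (Real.exp (2 * (domainRadius Ω * ρ) + (domainRadius Ω * ρ) ^ 2)) := by
    rw [stableSampling_iff hΩ]
    intro f hf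
    have hu := bandSpectrum_fourier hΩ hf
    set u : EuclideanSpace ℝ (Fin d) → ℂ :=
      ⇑(𝓕 f : Lp ℂ 2 (volume : Measure (EuclideanSpace ℝ (Fin d)))) with hudef
    have hterm0 : ∀ n, 0 ≤ ∑ α ∈ multiIndices d k, weight N x n α * ‖sampleDeriv f α (x n)‖ ^ 2 :=
      fun n => Finset.sum_nonneg fun α _ => mul_nonneg (weight_nonneg N x n α) (sq_nonneg _)
    have hterm : ∀ n, sampleEnergy (voronoiCell N x) x k u n = ENNReal.ofReal
        (∑ α ∈ multiIndices d k, weight N x n α * ‖sampleDeriv f α (x n)‖ ^ 2) := by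
      intro n
      rw [ENNReal.ofReal_sum_of_nonneg fun α _ =>
        mul_nonneg (weight_nonneg N x n α) (sq_nonneg _), sampleEnergy]
      refine Finset.sum_congr rfl fun α _ => ?_
      rw [ENNReal.ofReal_mul (weight_nonneg N x n α), hP.ofReal_weight,
        ENNReal.ofReal_pow (norm_nonneg _), ofReal_norm]
      rfl
    -- If `m_Ω = 0`, then `Ω ⊆ {0}` is a null set and `f = 0`.
    have hzero : domainRadius Ω = 0 → ∫⁻ ξ, ‖u ξ‖ₑ ^ 2 = 0 := by
      intro h0
      have : Nonempty (Fin d) := ⟨⟨0, hd⟩⟩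
      have hne : ∀ᵐ ξ : EuclideanSpace ℝ (Fin d), ξ ≠ 0 := by
        simp [ae_iff]
      refine (lintegral_congr_ae ?_).trans lintegral_zero
      filter_upwards [hu.vanish, hne] with ξ hξ hξ0
      have := norm_pos_iff.2 hξ0
      simp [hξ (by rw [h0]; positivity)]
    have hupper : ∑' n, sampleEnergy (voronoiCell N x) x k u n ≤
        ENNReal.ofReal (Real.exp (2 * (domainRadius Ω * ρ) + (domainRadius Ω * ρ) ^ 2)) *
          ∫⁻ ξ, ‖u ξ‖ₑ ^ 2 := by
      rcases hm.eq_or_lt with h0 | hpos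
      -- The sampling estimates need a positive band radius. When `m_Ω = 0` the band is enlarged to
      -- radius `1`, which is harmless since both sides vanish.
      · have hu1 : BandSpectrum 1 u := ⟨hu.memLp, hu.vanish.mono fun ξ hξ h => hξ (by linarith)⟩
        refine (hP.tsum_sampleEnergy_le_exp hρ0 one_pos hu1 k).trans ?_
        rw [hzero h0.symm, mul_zero, mul_zero]
      · exact hP.tsum_sampleEnergy_le_exp hρ0 hpos hu k
    have hlower : Real.exp (-(d : ℝ)) * (1 - q) ^ 2 * (∫⁻ ξ, ‖u ξ‖ₑ ^ 2).toReal ≤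
        (∑' n, sampleEnergy (voronoiCell N x) x k u n).toReal := by
      rcases hm.eq_or_lt with h0 | hpos
      · rw [hzero h0.symm]
        simp
      · exact hP.le_tsum_sampleEnergy hd hρ0 hpos hu k hq1
    have hfin : ENNReal.ofReal (Real.exp (2 * (domainRadius Ω * ρ) + (domainRadius Ω * ρ) ^ 2)) *
        ∫⁻ ξ, ‖u ξ‖ₑ ^ 2 ≠ ⊤ :=
      ENNReal.mul_ne_top ENNReal.ofReal_ne_top hu.lintegral_enorm_sq_ne_top
    have htsum : (∑' n, sampleEnergy (voronoiCell N x) x k u n).toReal =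
        ∑' n, ∑ α ∈ multiIndices d k, weight N x n α * ‖sampleDeriv f α (x n)‖ ^ 2 := by
      rw [ENNReal.tsum_toReal_eq fun n => by rw [hterm]; exact ENNReal.ofReal_ne_top]
      exact tsum_congr fun n => by rw [hterm, ENNReal.toReal_ofReal (hterm0 n)]
    refine ⟨?_, ?_, ?_⟩
    · refine (ENNReal.summable_toReal (ne_top_of_le_ne_top hfin hupper)).congr fun n => ?_
      rw [hterm, ENNReal.toReal_ofReal (hterm0 n)]
    · rw [← htsum, norm_sq_eq_lintegral_fourier]
      exact hlower
    · rw [← htsum, norm_sq_eq_lintegral_fourier]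
      have := ENNReal.toReal_mono hfin hupper
      rwa [ENNReal.toReal_mul, ENNReal.toReal_ofReal hB.le] at this
  exact ⟨_, _, hA, hB, le_rfl, le_rfl, hstable, (hiff _ _ hA hB).1 hstable⟩
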